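/- Let $\widetilde\nu$ and $\nu$ be random variables defined on a common probability space, with values in $\mathbb R_+=[0,\infty)$ and in $\mathbb N=\{0,1,2,\dots\}$ respectively, such that $E[\nu]=1$. Let $M$ be an $\mathbb R_+$-valued random variable whose distribution satisfies $$M\overset{d}{=}\max\Big\{\widetilde\nu,\ \max_{1\le k\le \nu}M_k\Big\},$$ where $M_1,M_2,\dots$ are i.i.d. copies of $M$, independent of $(\widetilde\nu,\nu)$ (an empty maximum is $0$). Let $\|\cdot\|$ be a norm on $\mathbb R^2$, let $X=(\widetilde\nu,\nu)$, let $V(x)=P(\|X\|>x)$ for $x>0$, and let $\alpha\in(1,2)$. Suppose that $X$ is regularly varying of index $\alpha$ associated with $V$ and $\mu$, that is: $V(x)>0$ for all $x>0$ and $V(xy)/V(x)\to y^{-\alpha}$ as $x\to\infty$ for every $y>0$, and $\mu$ is a nonzero Radon measure on $\mathbb R^2\setminus\{0\}$ such that, for every continuous $f:\mathbb R^2\to[0,\infty)$ whose support is compact and does not contain $0$, $$\frac{1}{V(x)}E\big[f(x^{-1}X)\big]\longrightarrow\int f\,d\mu\qquad (x\to\infty).$$ Suppose that $$\mu(\{y\in\mathbb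 R_+^2:\ y_1>0,\ y_2>1\})>0\quad\text{and}\quad \mu(\{y\in\mathbb R_+^2:\ y_2=1<\|y\|\})=0,$$ and that there are $c_1,c_2\in(0,\infty)$ such that, as $x\to\infty$, $$\frac{P(\nu>x)}{P(\|X\|>x)}\to c_1\quad\text{and}\quad\frac{P(\widetilde\nu>x)}{P(\|X\|>x)}\to c_2.$$ Then the integral $\int_{\mathbb R_+^2}e^{-xy_2}1_{\{y_1>1\}}\,\mu(dy)$ is finite for every $x>0$, the equation $$c_1\alpha\Gamma(-\alpha)x^\alpha-\int_{\mathbb R_+^2}e^{-xy_2}1_{\{y_1>1\}}\,\mu(dy)=0$$ has exactly one solution $x=C_{\alpha,\mu}$ in $(0,\infty)$, and $$P(M>r)\sim\frac{C_{\alpha,\mu}}{r}\qquad\text{as } r\to\infty.$$ -/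

import Mathlib

open MeasureTheory ProbabilityTheory Filter Topology Asymptotics
open scoped NNReal

/-- A function `V : (0,∞) → (0,∞)` (represented by a function on `ℝ`, whose values on `(-∞,0]` play
no role) that is measurable and regularly varying at infinity of index `ρ`. -/
structure RegularlyVaryingFunction (V : ℝ → ℝ) (ρ : ℝ) : Prop where
  pos : ∀ x : ℝ, 0 < x → 0 < V x
  measurable : Measurable (fun x : Set.Ioi (0 : ℝ) => V x)
  tendsto : ∀ y : ℝ, 0 < y → Tendsto (fun x : ℝ => V (x * y) / V x) atTop (𝓝 (y ^ ρ))

/-- A Radon measure on the punctured plane `ℝ² ∖ {0}`, seen as a Borel measure on `ℝ²` which does not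
charge the origin: it is finite on the compact sets that do not contain the origin. -/
structure IsRadonOffZero (μ : Measure (ℝ × ℝ)) : Prop where
  zero : μ {0} = 0
  finite_of_isCompact : ∀ K : Set (ℝ × ℝ), IsCompact K → (0 : ℝ × ℝ) ∉ K → μ K < ⊤

/-- The random vector `X` in the plane is regularly varying of index `α`, associated with the
normalizing function `V` and with the limit measure `μ`: the function `V` is regularly varying of
index `-α`, `μ` is a nonzero Radon measure on `ℝ² ∖ {0}`, and the measures `P(X / x ∈ ·) / V x`
converge vaguely on `ℝ² ∖ {0}` to `μ` as `x → ∞`. -/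
structure RegularlyVaryingVector {Ω : Type*} [MeasurableSpace Ω] (P : Measure Ω)
    (X : Ω → ℝ × ℝ) (α : ℝ) (V : ℝ → ℝ) (μ : Measure (ℝ × ℝ)) : Prop where
  regularlyVarying : RegularlyVaryingFunction V (-α)
  radon : IsRadonOffZero μ
  ne_zero : μ ≠ 0
  vague : ∀ f : ℝ × ℝ → ℝ, Continuous f → HasCompactSupport f → (0 : ℝ × ℝ) ∉ tsupport f →
    (∀ y, 0 ≤ f y) →
    Tendsto (fun x : ℝ => (∫ ω, f (x⁻¹ • X ω) ∂P) / V x) atTop (𝓝 (∫ y, f y ∂μ))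

/-- The random variable `M` (on some probability space) satisfies the equation in distribution
`M = max {νt, max_{1 ≤ k ≤ ν} Mk k}`, where the `Mk k` are i.i.d. copies of `M`, independent
of the pair `(νt, ν)`. The maximum over the empty set is `0`, the least element of `ℝ≥0`. -/
structure SolvesMaxEquation {Ω Ω' : Type*} [MeasurableSpace Ω] [MeasurableSpace Ω']
    (P : Measure Ω) (P' : Measure Ω') (νt : Ω → ℝ≥0) (ν : Ω → ℕ)
    (Mk : ℕ → Ω → ℝ≥0) (M : Ω' → ℝ≥0) : Prop where
  identDistrib_copy : ∀ k, IdentDistrib (Mk k) M P P'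
  iIndep : iIndepFun Mk P
  indep : IndepFun (fun ω => (νt ω, ν ω)) (fun ω k => Mk k ω) P
  identDistrib_max :
    IdentDistrib M (fun ω => max (νt ω) ((Finset.Icc 1 (ν ω)).sup fun k => Mk k ω)) P' P

/-! Write `G r` for the tail of `M` and consider the defect `Φ_r(s) = E[(1-s)^ν; νt ≤ r] - (1-s)`.
Conditioning on `(νt, ν)` turns the max-equation into `Φ_r(G r) = 0`
(`SolvesMaxEquation.one_sub_tail_eq`). Since `E ν = 1`, `Φ_r` is nondecreasing on `[0,1]`
(`setIntegral_one_sub_pow_sub_mono`), so the sign of `Φ_r(x/r)` tells on which side of `x/r` the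
number `G r` lies.

That sign is found asymptotically in `tendsto_fixedPoint_defect_div`. Replacing `(1-x/r)^ν` by
`exp(-xν/r)` costs `O(r⁻²) = o(V r)` because `α < 2`. What remains is `E[exp(-xν/r) - 1 + xν/r] -
E[exp(-xν/r); νt > r]`. Divided by `V r`, the first term tends to `c₁ α Γ(-α) x^α` by a Tauberian
computation with Potter domination (`tendsto_integral_exp_neg_sub_one_add_div`), and the second to
the integral against `μ` by vague convergence (`RegularlyVaryingVector.tendsto_setIntegral_exp`).

The limit is strictly increasing in `x` and has a unique positive zero `C`. For `x < C` the defect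
at `x/r` is eventually negative, hence `G r > x/r`; for `x > C` the inequality reverses. Thus `r * G
r → C`. -/

/-! ### Elementary inequalities for powers. -/

theorem pow_sub_pow_le_nat_mul_sub {a b : ℝ} (hb : 0 ≤ b) (hab : b ≤ a) (ha : a ≤ 1) (n : ℕ) :
    a ^ n - b ^ n ≤ n * (a - b) := by
  induction n with
  | zero => simp
  | succ n ih =>
    have h1 : b ^ n ≤ 1 := pow_le_one₀ hb (hab.trans ha)
    have h2 : 0 ≤ b ^ n := pow_nonneg hb n
    have h3 : b ^ n ≤ a ^ n := pow_le_pow_left₀ hb hab n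
    push_cast
    have : a ^ (n + 1) - b ^ (n + 1) = a * (a ^ n - b ^ n) + b ^ n * (a - b) := by ring
    rw [this]
    nlinarith [mul_le_mul_of_nonneg_right ha (sub_nonneg.2 h3),
      mul_le_mul_of_nonneg_right h1 (sub_nonneg.2 hab)]

/-- Compare `n`-th powers of `exp (-s)` and `1 - s`, which differ by at most `s ^ 2`. The bound is
linear in `n`, so a finite first moment of `ν` suffices to integrate it, although its second moment
may be infinite. -/
theorem exp_neg_pow_sub_one_sub_pow_le {s : ℝ} (hs : 0 ≤ s) (hs1 : s ≤ 1) (n : ℕ) :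
    |Real.exp (-s * n) - (1 - s) ^ n| ≤ n * s ^ 2 := by
  have h0 : 1 - s ≤ Real.exp (-s) := by linarith [Real.add_one_le_exp (-s)]
  have h1 : Real.exp (-s) - (1 - s) ≤ s ^ 2 := by
    have := Real.abs_exp_sub_one_sub_id_le (x := -s) (by rw [abs_neg, abs_of_nonneg hs]; exact hs1)
    have := (abs_le.1 this).2
    nlinarith
  have h2 : Real.exp (-s * n) = Real.exp (-s) ^ n := by
    rw [← Real.exp_nat_mul]; ring_nf
  have h3 : 0 ≤ 1 - s := by linarith
  rw [h2, abs_of_nonneg (sub_nonneg.2 (pow_le_pow_left₀ h3 h0 n))]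
  refine (pow_sub_pow_le_nat_mul_sub h3 h0 (Real.exp_le_one_iff.2 (by linarith)) n).trans ?_
  gcongr

/-! ### Potter bounds. -/

/-- Potter's bound for a positive nonincreasing function that is regularly varying at infinity. -/
theorem exists_potter_bound {U : ℝ → ℝ} {α p q : ℝ} (hanti : Antitone U) (hpos : ∀ x, 0 < U x)
    (hle : ∀ x, U x ≤ 1)
    (hU : Tendsto (fun x => U (x * 2) / U x) atTop (𝓝 (2 ^ (-α)))) (hp0 : 0 ≤ p) (hp : p < α)
    (hq : α < q) :
    ∃ C r₀ : ℝ, 0 < C ∧ 0 < r₀ ∧ ∀ r, r₀ ≤ r → ∀ t, 0 < t →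
      U (r * t) ≤ C * (t ^ (-p) + t ^ (-q)) * U r := by
  have e1 : ∀ᶠ x in atTop, U (x * 2) / U x < 2 ^ (-p) := hU.eventually_lt_const
    (Real.rpow_lt_rpow_of_exponent_lt (by norm_num) (by linarith))
  have e2 : ∀ᶠ x in atTop, 2 ^ (-q) < U (x * 2) / U x := hU.eventually_const_lt
    (Real.rpow_lt_rpow_of_exponent_lt (by norm_num) (by linarith))
  obtain ⟨r₁, hr₁⟩ := eventually_atTop.1 (e1.and e2)
  set r₀ := max r₁ 1 with hr₀
  have hr0 : 0 < r₀ := lt_of_lt_of_le one_pos (le_max_right _ _)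
  have hq0 : 0 ≤ q := by linarith
  -- Iterating the one-step doubling estimate gives both bounds along powers of two; monotonicity
  -- then fills the gaps, at the price of a factor `2 ^ p` or `2 ^ q`.
  have up : ∀ k : ℕ, ∀ r, r₀ ≤ r → U (r * 2 ^ k) ≤ ((2 : ℝ) ^ (-p)) ^ k * U r := by
    intro k
    induction k with
    | zero => intro r _; simp
    | succ k ih =>
      intro r hr
      have h1 := ih (r * 2) (by linarith)
      have h2 := (hr₁ r ((le_max_left _ _).trans hr)).1
      rw [div_lt_iff₀ (hpos r)] at h2
      calc U (r * 2 ^ (k + 1)) = U (r * 2 * 2 ^ k) := by ring_nf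
        _ ≤ _ := h1
        _ ≤ ((2 : ℝ) ^ (-p)) ^ k * ((2 : ℝ) ^ (-p) * U r) := by gcongr
        _ = _ := by ring
  have down : ∀ k : ℕ, ∀ r, r₀ ≤ r → U r ≤ ((2 : ℝ) ^ q) ^ k * U (r * 2 ^ k) := by
    intro k
    induction k with
    | zero => intro r _; simp
    | succ k ih =>
      intro r hr
      have h1 := ih (r * 2) (by linarith)
      have h2 := (hr₁ r ((le_max_left _ _).trans hr)).2
      rw [lt_div_iff₀ (hpos r), Real.rpow_neg (by norm_num), inv_mul_lt_iff₀ (by positivity)] at h2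
      calc U r ≤ (2 : ℝ) ^ q * U (r * 2) := h2.le
        _ ≤ (2 : ℝ) ^ q * (((2 : ℝ) ^ q) ^ k * U (r * 2 * 2 ^ k)) := by gcongr
        _ = _ := by rw [show r * 2 * 2 ^ k = r * 2 ^ (k + 1) by ring]; ring
  have comm : ∀ (e : ℝ) (k : ℕ), ((2 : ℝ) ^ e) ^ k = ((2 : ℝ) ^ k) ^ e := by
    intro e k
    rw [← Real.rpow_natCast, ← Real.rpow_natCast, ← Real.rpow_mul (by norm_num),
      ← Real.rpow_mul (by norm_num), mul_comm]
  have up' : ∀ r, r₀ ≤ r → ∀ z, 1 ≤ z → U (r * z) ≤ 2 ^ p * z ^ (-p) * U r := by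
    intro r hr z hz
    obtain ⟨k, hk1, hk2⟩ := exists_nat_pow_near hz (one_lt_two)
    have hr' : 0 ≤ r := hr0.le.trans hr
    refine (hanti (mul_le_mul_of_nonneg_left hk1 hr')).trans ((up k r hr).trans ?_)
    refine mul_le_mul_of_nonneg_right ?_ (hpos r).le
    have h1 : ((2 : ℝ) ^ (k + 1)) ^ (-p) ≤ z ^ (-p) :=
      Real.rpow_le_rpow_of_nonpos (by linarith) hk2.le (by linarith)
    rw [← comm, pow_succ] at h1
    have h2 : (2 : ℝ) ^ p * 2 ^ (-p) = 1 := by rw [← Real.rpow_add (by norm_num)]; simp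
    calc ((2 : ℝ) ^ (-p)) ^ k = ((2 : ℝ) ^ p * 2 ^ (-p)) * ((2 : ℝ) ^ (-p)) ^ k := by simp [h2]
      _ = 2 ^ p * (((2 : ℝ) ^ (-p)) ^ k * 2 ^ (-p)) := by ring
      _ ≤ _ := by gcongr
  have down' : ∀ r, r₀ ≤ r → ∀ z, 1 ≤ z → U r ≤ 2 ^ q * z ^ q * U (r * z) := by
    intro r hr z hz
    obtain ⟨k, hk1, hk2⟩ := exists_nat_pow_near hz (one_lt_two)
    have hr' : 0 ≤ r := hr0.le.trans hr
    refine (down (k + 1) r hr).trans ?_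
    have h1 : ((2 : ℝ) ^ k) ^ q ≤ z ^ q := Real.rpow_le_rpow (by positivity) hk1 hq0
    rw [← comm] at h1
    rw [pow_succ, mul_comm (((2 : ℝ) ^ q) ^ k)]
    have := hpos (r * z)
    exact mul_le_mul (by gcongr) (hanti (mul_le_mul_of_nonneg_left hk2.le hr')) (hpos _).le
      (by positivity)
  have hU0 := hpos r₀
  have h2q : (2 : ℝ) ^ q ≤ 2 ^ q / U r₀ := le_div_self (by positivity) hU0 (hle _)
  refine ⟨2 ^ p + 2 ^ q / U r₀, r₀, by positivity, hr0, fun r hr t ht => ?_⟩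
  have hr' : 0 < r := hr0.trans_le hr
  have hUr := hpos r
  have htp : 0 < t ^ (-p) := Real.rpow_pos_of_pos ht _
  have htq : 0 < t ^ (-q) := Real.rpow_pos_of_pos ht _
  have h2p : (0 : ℝ) < 2 ^ p := by positivity
  have h2q' : (0 : ℝ) < 2 ^ q := by positivity
  rcases le_or_gt 1 t with h1 | h1
  · refine (up' r hr t h1).trans (mul_le_mul_of_nonneg_right ?_ hUr.le)
    exact mul_le_mul (by linarith) (by linarith) htp.le (by linarith)
  · suffices U (r * t) ≤ 2 ^ q / U r₀ * t ^ (-q) * U r by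
      refine this.trans (mul_le_mul_of_nonneg_right ?_ hUr.le)
      exact mul_le_mul (by linarith) (by linarith) htq.le (by linarith)
    have hinv : t ^ (-q) = (1 / t) ^ q := by
      rw [one_div, Real.inv_rpow ht.le, Real.rpow_neg ht.le]
    rcases le_or_gt r₀ (r * t) with h2 | h2
    · have := down' (r * t) h2 (1 / t) (by rw [le_div_iff₀ ht]; linarith)
      rw [mul_assoc r, mul_one_div_cancel ht.ne', mul_one, ← hinv] at this
      refine this.trans ?_
      gcongr
    -- Here `r * t` lies below `r₀`, out of reach of the doubling estimate. The trivial bound `U ≤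
    -- 1` is used instead, with `U r₀` compared to `U r`; this is the origin of the constant `2 ^ q
    -- / U r₀`.
    · have := down' r₀ le_rfl (r / r₀) (by rwa [le_div_iff₀ hr0, one_mul])
      rw [mul_div_cancel₀ _ hr0.ne'] at this
      refine (hle _).trans ?_
      rw [div_mul_eq_mul_div, div_mul_eq_mul_div, le_div_iff₀ hU0, one_mul]
      refine this.trans ?_
      rw [hinv]
      have : r / r₀ ≤ 1 / t := by
        rw [div_le_div_iff₀ hr0 ht]; linarith
      have h5 : (0 : ℝ) ≤ r / r₀ := by positivity
      gcongr

/-- Potter's bound at `t = 1 / r` shows that `1 / U r` grows at most like `r ^ q` for some `q`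
strictly between `α` and `2`. -/
theorem tendsto_rpow_neg_two_div_zero {U : ℝ → ℝ} {α : ℝ} (hanti : Antitone U)
    (hpos : ∀ x, 0 < U x) (hle : ∀ x, U x ≤ 1)
    (hU : Tendsto (fun x => U (x * 2) / U x) atTop (𝓝 (2 ^ (-α)))) (hα₁ : 1 < α) (hα₂ : α < 2) :
    Tendsto (fun r => (r ^ 2)⁻¹ / U r) atTop (𝓝 0) := by
  obtain ⟨C, r₀, hC, hr₀, h⟩ := exists_potter_bound (p := 0) (q := (α + 2) / 2) hanti hpos hle hU
    le_rfl (by linarith) (by linarith)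
  have hlim : Tendsto (fun r : ℝ => C / U 1 * (r ^ (-(2 : ℝ)) + r ^ (-((2 - α) / 2)))) atTop
      (𝓝 (C / U 1 * (0 + 0))) :=
    ((tendsto_rpow_neg_atTop (by norm_num)).add
      (tendsto_rpow_neg_atTop (by linarith))).const_mul _
  simp only [add_zero, mul_zero] at hlim
  refine squeeze_zero' (Eventually.of_forall fun r => ?_) ?_ hlim
  · have := hpos r; positivity
  · filter_upwards [eventually_ge_atTop r₀] with r hr
    have hr' : 0 < r := hr₀.trans_le hr
    have h1 := h r hr r⁻¹ (by positivity)
    rw [mul_inv_cancel₀ hr'.ne', neg_zero, Real.rpow_zero, Real.inv_rpow hr'.le, Real.rpow_neg hr'.le,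
      inv_inv] at h1
    have h2 : r ^ (-((2 - α) / 2)) = (r ^ 2)⁻¹ * r ^ ((α + 2) / 2) := by
      rw [← Real.rpow_natCast, ← Real.rpow_neg hr'.le, ← Real.rpow_add hr']
      congr 1; push_cast; ring
    have h3 : r ^ (-(2 : ℝ)) = (r ^ 2)⁻¹ := by
      rw [Real.rpow_neg hr'.le, Real.rpow_two]
    rw [h2, h3, div_le_iff₀ (hpos r), ← mul_one_add, div_mul_eq_mul_div, div_mul_eq_mul_div,
      le_div_iff₀ (hpos 1)]
    have : 0 < (r ^ 2)⁻¹ := by positivity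
    calc (r ^ 2)⁻¹ * U 1 ≤ (r ^ 2)⁻¹ * (C * (1 + r ^ ((α + 2) / 2)) * U r) := by gcongr
      _ = _ := by ring

/-! ### Tauberian asymptotics of the Laplace transform. -/

theorem integrableOn_one_sub_exp_neg_mul_rpow {p : ℝ} (hp₁ : 1 < p) (hp₂ : p < 2) :
    IntegrableOn (fun t : ℝ => (1 - Real.exp (-t)) * t ^ (-p)) (Set.Ioi 0) := by
  have hm : Measurable (fun t : ℝ => (1 - Real.exp (-t)) * t ^ (-p)) := by fun_prop
  rw [← Set.Ioc_union_Ioi_eq_Ioi zero_le_one]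
  refine IntegrableOn.union ?_ ?_
  · have h1 : IntegrableOn (fun t : ℝ => t ^ (1 - p)) (Set.Ioc 0 1) := by
      rw [← intervalIntegrable_iff_integrableOn_Ioc_of_le zero_le_one]
      exact intervalIntegral.intervalIntegrable_rpow' (by linarith)
    refine Integrable.mono' h1 hm.aestronglyMeasurable ?_
    refine (ae_restrict_iff' measurableSet_Ioc).2 (Eventually.of_forall fun t ht => ?_)
    have h2 : 0 ≤ 1 - Real.exp (-t) := by
      have := Real.exp_le_one_iff.2 (by linarith [ht.1] : -t ≤ 0); linarith
    have h3 : 1 - Real.exp (-t) ≤ t := by linarith [Real.add_one_le_exp (-t)]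
    have h4 : 0 < t ^ (-p) := Real.rpow_pos_of_pos ht.1 _
    rw [Real.norm_of_nonneg (by positivity), sub_eq_add_neg 1 p, Real.rpow_add ht.1, Real.rpow_one]
    gcongr
  · have h1 : IntegrableOn (fun t : ℝ => t ^ (-p)) (Set.Ioi 1) :=
      integrableOn_Ioi_rpow_of_lt (by linarith) one_pos
    refine Integrable.mono' h1 hm.aestronglyMeasurable ?_
    refine (ae_restrict_iff' measurableSet_Ioi).2 (Eventually.of_forall fun t ht => ?_)
    have ht : 1 < t := ht
    have h2 : 0 ≤ 1 - Real.exp (-t) := by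
      have := Real.exp_le_one_iff.2 (by linarith : -t ≤ 0); linarith
    have h4 : 0 < t ^ (-p) := Real.rpow_pos_of_pos (by linarith) _
    rw [Real.norm_of_nonneg (by positivity)]
    nlinarith [Real.exp_pos (-t)]

theorem Gamma_two_sub_eq {α : ℝ} (hα : 1 < α) :
    Real.Gamma (2 - α) = (1 - α) * (-α * Real.Gamma (-α)) := by
  rw [← Real.Gamma_add_one (by linarith : -α ≠ 0), show -α + 1 = 1 - α by ring,
    ← Real.Gamma_add_one (by linarith : 1 - α ≠ 0)]
  ring_nf

/-- Integration by parts against `t ^ (1 - α) / (1 - α)` has vanishing boundary terms exactly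
because `1 < α < 2`, and leaves `-Γ(2 - α) / (1 - α)`. -/
theorem integral_one_sub_exp_neg_mul_rpow {α : ℝ} (hα₁ : 1 < α) (hα₂ : α < 2) :
    ∫ t in Set.Ioi (0 : ℝ), (1 - Real.exp (-t)) * t ^ (-α) = α * Real.Gamma (-α) := by
  have h1α : 1 - α ≠ 0 := by linarith
  have hGi := Real.GammaIntegral_convergent (s := 2 - α) (by linarith)
  have hparts := integral_Ioi_mul_deriv_eq_deriv_mul (a := (0 : ℝ)) (a' := 0) (b' := 0)
    (u := fun t => 1 - Real.exp (-t)) (v := fun t => t ^ (1 - α) / (1 - α))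
    (u' := fun t => Real.exp (-t)) (v' := fun t => t ^ (-α))
    (fun t _ => by
      have := ((hasDerivAt_neg t).exp).const_sub 1
      simpa using this)
    (fun t ht => by
      have := (Real.hasDerivAt_rpow_const (x := t) (p := 1 - α) (Or.inl (ne_of_gt ht))).div_const
        (1 - α)
      rw [mul_div_cancel_left₀ _ h1α] at this
      convert this using 2; ring)
    (by simpa using! integrableOn_one_sub_exp_neg_mul_rpow hα₁ hα₂)
    (by
      refine (hGi.div_const (1 - α)).congr (Eventually.of_forall fun t => ?_)
      simp only [Pi.mul_apply]
      rw [show 2 - α - 1 = 1 - α by ring]; ring)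
    (by
      have hlim : Tendsto (fun t : ℝ => t ^ (2 - α) / (α - 1)) (𝓝[>] 0) (𝓝 0) := by
        have := ((Real.continuousAt_rpow_const 0 (2 - α) (Or.inr (by linarith))).tendsto).div_const
          (α - 1)
        rw [Real.zero_rpow (by linarith), zero_div] at this
        exact this.mono_left nhdsWithin_le_nhds
      refine squeeze_zero_norm' ?_ hlim
      filter_upwards [self_mem_nhdsWithin] with t ht
      have ht : 0 < t := ht
      have h2 : 0 ≤ 1 - Real.exp (-t) := by
        have := Real.exp_le_one_iff.2 (by linarith : -t ≤ 0); linarith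
      have h3 : 1 - Real.exp (-t) ≤ t := by linarith [Real.add_one_le_exp (-t)]
      have h4 : 0 < t ^ (1 - α) := Real.rpow_pos_of_pos ht _
      simp only [Pi.mul_apply]
      rw [norm_mul, norm_div, Real.norm_of_nonneg h2, Real.norm_of_nonneg h4.le,
        Real.norm_of_nonpos (by linarith : 1 - α ≤ 0), neg_sub, ← mul_div_assoc,
        show 2 - α = 1 + (1 - α) by ring, Real.rpow_add ht, Real.rpow_one]
      have : 0 < α - 1 := by linarith
      gcongr)
    (by
      have hlim : Tendsto (fun t : ℝ => t ^ (-(α - 1)) / (α - 1)) atTop (𝓝 0) := by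
        have := (tendsto_rpow_neg_atTop (by linarith : 0 < α - 1)).div_const (α - 1)
        rwa [zero_div] at this
      refine squeeze_zero_norm' ?_ hlim
      filter_upwards [eventually_gt_atTop 0] with t ht
      have h2 : 0 ≤ 1 - Real.exp (-t) := by
        have := Real.exp_le_one_iff.2 (by linarith : -t ≤ 0); linarith
      have h3 : 1 - Real.exp (-t) ≤ 1 := by linarith [Real.exp_pos (-t)]
      have h4 : 0 < t ^ (1 - α) := Real.rpow_pos_of_pos ht _
      simp only [Pi.mul_apply]
      rw [norm_mul, norm_div, Real.norm_of_nonneg h2, Real.norm_of_nonneg h4.le,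
        Real.norm_of_nonpos (by linarith : 1 - α ≤ 0), neg_sub, neg_sub]
      have : 0 < α - 1 := by linarith
      exact mul_le_of_le_one_left (by positivity) h3)
  rw [hparts]
  have : ∫ t in Set.Ioi (0 : ℝ), Real.exp (-t) * (t ^ (1 - α) / (1 - α)) =
      Real.Gamma (2 - α) / (1 - α) := by
    rw [Real.Gamma_eq_integral (by linarith), ← integral_div]
    congr 1; ext t
    rw [show 2 - α - 1 = 1 - α by ring]; ring
  rw [this, Gamma_two_sub_eq hα₁]
  field_simp
  ring

/-- Layer-cake formula: `1 - exp (-t)` has primitive `exp (-u) - 1 + u` vanishing at `0`. -/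
theorem integral_exp_neg_sub_one_add_eq {Ω : Type*} [MeasurableSpace Ω] (P : Measure Ω)
    [IsProbabilityMeasure P] {X : Ω → ℝ} (hX : Measurable X) (hX0 : ∀ ω, 0 ≤ X ω) {ρ : ℝ}
    (hρ : 0 < ρ) :
    ∫ ω, (Real.exp (-(X ω / ρ)) - 1 + X ω / ρ) ∂P =
      ∫ t in Set.Ioi (0 : ℝ), (1 - Real.exp (-t)) * P.real {ω | ρ * t < X ω} := by
  have hprim : ∀ u : ℝ, ∫ t in (0 : ℝ)..u, (1 - Real.exp (-t)) = Real.exp (-u) - 1 + u := by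
    intro u
    rw [intervalIntegral.integral_eq_sub_of_hasDerivAt (f := fun t => t + Real.exp (-t))]
    · simp; ring
    · intro t _
      have := (hasDerivAt_id t).add (hasDerivAt_neg t).exp
      simpa [sub_eq_add_neg] using! this
    · exact (by fun_prop : Continuous fun t : ℝ => 1 - Real.exp (-t)).intervalIntegrable _ _
  have hlc := lintegral_comp_eq_lintegral_meas_lt_mul P (f := fun ω => X ω / ρ)
    (g := fun t => 1 - Real.exp (-t))
    (Eventually.of_forall fun ω => div_nonneg (hX0 ω) hρ.le)
    (hX.div_const _).aemeasurable
    (fun t _ => (by fun_prop : Continuous fun t : ℝ => 1 - Real.exp (-t)).intervalIntegrable _ _)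
    ((ae_restrict_iff' measurableSet_Ioi).2 (Eventually.of_forall fun t ht => by
      have ht : 0 < t := ht
      have := Real.exp_le_one_iff.2 (by linarith : -t ≤ 0)
      linarith))
  have hanti : Antitone fun t : ℝ => P.real {ω | ρ * t < X ω} := by
    intro a b hab
    exact measureReal_mono fun ω (h : ρ * b < X ω) => (mul_le_mul_of_nonneg_left hab hρ.le).trans_lt h
  rw [integral_eq_lintegral_of_nonneg_ae, integral_eq_lintegral_of_nonneg_ae]
  · congr 1
    simp only [hprim] at hlc
    rw [hlc]
    refine setLIntegral_congr_fun measurableSet_Ioi fun t ht => ?_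
    have ht : 0 < t := ht
    rw [mul_comm (1 - _), ENNReal.ofReal_mul measureReal_nonneg, ofReal_measureReal]
    congr 2
    ext ω
    simp only [Set.mem_ofPred_eq]
    rw [lt_div_iff₀ hρ, mul_comm]
  · refine (ae_restrict_iff' measurableSet_Ioi).2 (Eventually.of_forall fun t ht => ?_)
    have ht : 0 < t := ht
    have := Real.exp_le_one_iff.2 (by linarith : -t ≤ 0)
    exact mul_nonneg (by linarith) measureReal_nonneg
  · exact ((by fun_prop : Measurable fun t : ℝ => 1 - Real.exp (-t)).mul
      hanti.measurable).aestronglyMeasurable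
  · refine Eventually.of_forall fun ω => ?_
    have := Real.add_one_le_exp (-(X ω / ρ))
    simp only [Pi.zero_apply]; linarith
  · exact (by fun_prop : Measurable fun ω => Real.exp (-(X ω / ρ)) - 1 + X ω / ρ).aestronglyMeasurable

/-- The Tauberian-type asymptotics of the Laplace transform of a random variable with a regularly
varying tail of index between `1` and `2`. -/
theorem tendsto_integral_exp_neg_sub_one_add_div {Ω : Type*} [MeasurableSpace Ω] (P : Measure Ω)
    [IsProbabilityMeasure P] {X : Ω → ℝ} (hX : Measurable X) (hX0 : ∀ ω, 0 ≤ X ω) {α : ℝ}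
    (hα₁ : 1 < α) (hα₂ : α < 2) (hpos : ∀ x, 0 < P.real {ω | x < X ω})
    (hRV : ∀ y : ℝ, 0 < y → Tendsto (fun x => P.real {ω | x * y < X ω} / P.real {ω | x < X ω}) atTop
      (𝓝 (y ^ (-α)))) :
    Tendsto (fun ρ => (∫ ω, (Real.exp (-(X ω / ρ)) - 1 + X ω / ρ) ∂P) / P.real {ω | ρ < X ω}) atTop
      (𝓝 (α * Real.Gamma (-α))) := by
  set U : ℝ → ℝ := fun x => P.real {ω | x < X ω} with hUdef
  have hanti : Antitone U := fun a b hab => measureReal_mono fun ω (h : b < X ω) => hab.trans_lt h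
  -- Both exponents lie in `(1, 2)`, on either side of `α`, so each power is integrable against `1 -
  -- exp (-t)` and their sum dominates.
  obtain ⟨C, r₀, hC, hr₀, hb⟩ := exists_potter_bound (U := U) (α := α) (p := (1 + α) / 2)
    (q := (α + 2) / 2) hanti hpos (fun x => measureReal_le_one) (hRV 2 two_pos) (by linarith)
    (by linarith) (by linarith)
  rw [← integral_one_sub_exp_neg_mul_rpow hα₁ hα₂]
  have hconv : Tendsto (fun ρ => ∫ t in Set.Ioi (0 : ℝ), (1 - Real.exp (-t)) * (U (ρ * t) / U ρ))
      atTop (𝓝 (∫ t in Set.Ioi (0 : ℝ), (1 - Real.exp (-t)) * t ^ (-α))) := by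
    refine tendsto_integral_filter_of_dominated_convergence
      (fun t => C * ((1 - Real.exp (-t)) * t ^ (-((1 + α) / 2)) +
        (1 - Real.exp (-t)) * t ^ (-((α + 2) / 2)))) ?_ ?_ ?_ ?_
    · filter_upwards [eventually_gt_atTop 0] with ρ hρ
      have : Antitone fun t => U (ρ * t) := fun a b hab =>
        hanti (mul_le_mul_of_nonneg_left hab hρ.le)
      exact ((by fun_prop : Measurable fun t : ℝ => 1 - Real.exp (-t)).mul
        (this.measurable.div_const _)).aestronglyMeasurable
    · filter_upwards [eventually_ge_atTop r₀] with ρ hρ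
      refine (ae_restrict_iff' measurableSet_Ioi).2 (Eventually.of_forall fun t ht => ?_)
      have ht : 0 < t := ht
      have h1 : 0 ≤ 1 - Real.exp (-t) := by
        have := Real.exp_le_one_iff.2 (by linarith : -t ≤ 0); linarith
      have h2 : 0 ≤ U (ρ * t) / U ρ := div_nonneg measureReal_nonneg measureReal_nonneg
      rw [Real.norm_of_nonneg (mul_nonneg h1 h2), ← mul_add, mul_left_comm]
      refine mul_le_mul_of_nonneg_left ?_ h1
      rw [div_le_iff₀ (hpos ρ)]
      exact hb ρ hρ t ht
    · exact ((integrableOn_one_sub_exp_neg_mul_rpow (by linarith) (by linarith)).add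
        (integrableOn_one_sub_exp_neg_mul_rpow (by linarith) (by linarith))).const_mul C
    · refine (ae_restrict_iff' measurableSet_Ioi).2 (Eventually.of_forall fun t ht => ?_)
      exact (hRV t ht).const_mul _
  refine hconv.congr' ?_
  filter_upwards [eventually_gt_atTop 0] with ρ hρ
  rw [integral_exp_neg_sub_one_add_eq P hX hX0 hρ, ← integral_div]
  simp only [hUdef, mul_div_assoc]

/-! ### From vague convergence to the integral over `{1 < y.1}`. -/

theorem IsRadonOffZero.integrable {μ : Measure (ℝ × ℝ)} (hμ : IsRadonOffZero μ) {f : ℝ × ℝ → ℝ}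
    (hf : Continuous f) (hc : HasCompactSupport f) (h0 : (0 : ℝ × ℝ) ∉ tsupport f) :
    Integrable f μ := by
  have hfin : μ (tsupport f) < ⊤ := hμ.finite_of_isCompact _ hc h0
  rw [← integrableOn_iff_integrable_of_support_subset (subset_tsupport f)]
  obtain ⟨C, hC⟩ := hc.exists_bound_of_continuous hf
  exact Measure.integrableOn_of_bounded hfin.ne hf.aestronglyMeasurable
    (Eventually.of_forall hC)

/-- Vague convergence bounds the limit measure of an open set by the limit of its measures. -/
theorem RegularlyVaryingVector.measure_isOpen_le {Ω : Type*} [MeasurableSpace Ω] {P : Measure Ω}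
    [IsProbabilityMeasure P] {X : Ω → ℝ × ℝ} {α : ℝ} {V : ℝ → ℝ} {μ : Measure (ℝ × ℝ)}
    (hX : RegularlyVaryingVector P X α V μ) (hXm : Measurable X) {U : Set (ℝ × ℝ)} (hU : IsOpen U)
    (h0 : (0 : ℝ × ℝ) ∉ U) {g : ℝ → ℝ} {c : ℝ}
    (hg : ∀ᶠ x in atTop, P.real {ω | x⁻¹ • X ω ∈ U} ≤ g x)
    (hgc : Tendsto (fun x => g x / V x) atTop (𝓝 c)) : μ U ≤ ENNReal.ofReal c := by
  -- The open set is exhausted by an increasing sequence of compacts, and each of them is separated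
  -- from its complement by a continuous test function.
  obtain ⟨F, hFc, hFU, hFun, hFmono⟩ := hU.exists_iUnion_isClosed
  have hKmono : Monotone fun n : ℕ => F n ∩ Metric.closedBall (0 : ℝ × ℝ) n := fun m n hmn =>
    Set.inter_subset_inter (hFmono hmn) (Metric.closedBall_subset_closedBall (by exact_mod_cast hmn))
  have hKun : ⋃ n : ℕ, F n ∩ Metric.closedBall (0 : ℝ × ℝ) n = U := by
    rw [Set.iUnion_inter_of_monotone hFmono fun m n hmn =>
      Metric.closedBall_subset_closedBall (by exact_mod_cast hmn), hFun,
      Metric.iUnion_closedBall_nat, Set.inter_univ]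
  rw [← hKun, hKmono.measure_iUnion]
  refine iSup_le fun n => ?_
  set K := F n ∩ Metric.closedBall (0 : ℝ × ℝ) n with hK
  have hKc : IsCompact K := (isCompact_closedBall _ _).inter_left (hFc n)
  have hKU : K ⊆ U := Set.inter_subset_left.trans (hFU n)
  obtain ⟨f, hfU, hfc, hfK, hf01⟩ : ∃ f : C(ℝ × ℝ, ℝ), tsupport f ⊆ U ∧ HasCompactSupport f ∧
      Set.EqOn f 1 K ∧ ∀ y, f y ∈ Set.Icc (0 : ℝ) 1 := by
    obtain ⟨f, h1, h2, h3, h4⟩ := exists_continuousMap_one_of_isCompact_subset_isOpen hKc hU hKU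
    exact ⟨f, by assumption, by assumption, by assumption, by assumption⟩
  have hf0 : (0 : ℝ × ℝ) ∉ tsupport f := fun h => h0 (hfU h)
  have hfi : Integrable f μ := hX.radon.integrable f.continuous hfc hf0
  have hlim := hX.vague f f.continuous hfc hf0 fun y => (hf01 y).1
  have hle : ∫ y, f y ∂μ ≤ c := by
    refine le_of_tendsto_of_tendsto hlim hgc ?_
    filter_upwards [hg, eventually_gt_atTop 0] with x hx hx0
    refine div_le_div_of_nonneg_right (le_trans ?_ hx) (hX.regularlyVarying.pos x hx0).le
    have hms : MeasurableSet {ω | x⁻¹ • X ω ∈ U} := (hXm.const_smul x⁻¹) hU.measurableSet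
    rw [← integral_indicator_one hms]
    refine integral_mono_of_nonneg (Eventually.of_forall fun ω => (hf01 _).1)
      ((integrable_const (1 : ℝ)).indicator hms) (Eventually.of_forall fun ω => ?_)
    by_cases hω : x⁻¹ • X ω ∈ U
    · simpa [Set.indicator, hω] using (hf01 (x⁻¹ • X ω)).2
    · have : f (x⁻¹ • X ω) = 0 := image_eq_zero_of_notMem_tsupport fun h => hω (hfU h)
      simp [Set.indicator, hω, this]
  have hKm : MeasurableSet K := hKc.measurableSet
  have hKfin : μ K < ⊤ := hX.radon.finite_of_isCompact K hKc fun h => h0 (hKU h)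
  have hle2 : μ.real K ≤ ∫ y, f y ∂μ := by
    rw [← integral_indicator_one hKm]
    refine integral_mono_of_nonneg (Eventually.of_forall fun y => ?_) hfi
      (Eventually.of_forall fun y => ?_)
    · exact Set.indicator_nonneg (fun _ _ => zero_le_one) y
    · by_cases hy : y ∈ K
      · simp [Set.indicator, hy, hfK hy]
      · simpa [Set.indicator, hy] using (hf01 y).1
  rw [← ENNReal.ofReal_toReal hKfin.ne]
  exact ENNReal.ofReal_le_ofReal (hle2.trans hle)

/-- A continuous cutoff of `y ↦ 1{1 < y.1} exp (-x |y.2|)`. -/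
noncomputable def expCutoff (x δ R K : ℝ) (y : ℝ × ℝ) : ℝ :=
  max 0 (min 1 (min ((y.1 - 1) / δ) (R + 1 - y.1))) * max 0 (min 1 (K + 1 - |y.2|)) *
    Real.exp (-x * |y.2|)

theorem continuous_expCutoff (x δ R K : ℝ) : Continuous (expCutoff x δ R K) := by
  unfold expCutoff; fun_prop

theorem expCutoff_nonneg (x δ R K : ℝ) (y : ℝ × ℝ) : 0 ≤ expCutoff x δ R K y := by
  unfold expCutoff; positivity

theorem tsupport_expCutoff_subset (x : ℝ) {δ : ℝ} (hδ : 0 < δ) (R K : ℝ) :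
    tsupport (expCutoff x δ R K) ⊆ Set.Icc 1 (R + 1) ×ˢ Set.Icc (-(K + 1)) (K + 1) := by
  refine closure_minimal (fun y hy => ?_) (isClosed_Icc.prod isClosed_Icc)
  by_contra hcon
  apply hy
  unfold expCutoff
  by_cases h1 : y.1 ∈ Set.Icc 1 (R + 1)
  · have h2 : K + 1 < |y.2| := by
      by_contra! h3
      exact hcon ⟨h1, abs_le.1 h3⟩
    rw [max_eq_left (b := min 1 (K + 1 - |y.2|)) ((min_le_right _ _).trans (by linarith))]
    simp
  · have h2 : min ((y.1 - 1) / δ) (R + 1 - y.1) ≤ 0 := by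
      rw [Set.mem_Icc, not_and_or, not_le, not_le] at h1
      rcases h1 with h1 | h1
      · exact (min_le_left _ _).trans (div_nonpos_of_nonpos_of_nonneg (by linarith) hδ.le)
      · exact (min_le_right _ _).trans (by linarith)
    rw [max_eq_left (b := min 1 _) ((min_le_right _ _).trans h2)]
    simp

theorem hasCompactSupport_expCutoff (x : ℝ) {δ : ℝ} (hδ : 0 < δ) (R K : ℝ) :
    HasCompactSupport (expCutoff x δ R K) :=
  (isCompact_Icc.prod isCompact_Icc).of_isClosed_subset (isClosed_tsupport _)
    (tsupport_expCutoff_subset x hδ R K)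

theorem zero_notMem_tsupport_expCutoff (x : ℝ) {δ : ℝ} (hδ : 0 < δ) (R K : ℝ) :
    (0 : ℝ × ℝ) ∉ tsupport (expCutoff x δ R K) := fun h => by
  have := (tsupport_expCutoff_subset x hδ R K h).1.1
  simp at this
  linarith

/-- The three terms pay for the ramp next to `y.1 = 1`, for the truncation of large `y.1`, and for
the truncation of large `y.2`, where the exponential itself is at most `exp (-x * K)`. -/
theorem abs_indicator_exp_sub_expCutoff_le {x δ R K : ℝ} (hx : 0 < x) (hδ : 0 < δ)
    (y : ℝ × ℝ) (hy : 0 ≤ y.2) :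
    |{y : ℝ × ℝ | 1 < y.1 ∧ 0 ≤ y.2}.indicator (fun y => Real.exp (-x * y.2)) y -
        expCutoff x δ R K y| ≤
      {y : ℝ × ℝ | 1 < y.1 ∧ y.1 < 1 + δ}.indicator 1 y + {y : ℝ × ℝ | R < y.1}.indicator 1 y +
        Real.exp (-x * K) * {y : ℝ × ℝ | 1 < y.1}.indicator 1 y := by
  have i1 : (0 : ℝ) ≤ {y : ℝ × ℝ | 1 < y.1 ∧ y.1 < 1 + δ}.indicator 1 y :=
    Set.indicator_nonneg (fun _ _ => zero_le_one) y
  have i2 : (0 : ℝ) ≤ {y : ℝ × ℝ | R < y.1}.indicator 1 y :=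
    Set.indicator_nonneg (fun _ _ => zero_le_one) y
  have i3 : (0 : ℝ) ≤ Real.exp (-x * K) * {y : ℝ × ℝ | 1 < y.1}.indicator 1 y :=
    mul_nonneg (Real.exp_pos _).le (Set.indicator_nonneg (fun _ _ => zero_le_one) y)
  unfold expCutoff
  rw [abs_of_nonneg hy]
  by_cases h1 : 1 < y.1
  swap
  · have h2 : min ((y.1 - 1) / δ) (R + 1 - y.1) ≤ 0 :=
      (min_le_left _ _).trans (div_nonpos_of_nonpos_of_nonneg (by linarith) hδ.le)
    rw [max_eq_left (b := min 1 (min _ _)) ((min_le_right _ _).trans h2),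
      Set.indicator_of_notMem (by simp [h1])]
    simp only [zero_mul, sub_zero, abs_zero]
    positivity
  rw [Set.indicator_of_mem (show y ∈ {y : ℝ × ℝ | 1 < y.1 ∧ 0 ≤ y.2} from ⟨h1, hy⟩)]
  set χ := max 0 (min 1 (min ((y.1 - 1) / δ) (R + 1 - y.1))) with hχ
  set k := max 0 (min 1 (K + 1 - y.2)) with hk
  have χ0 : 0 ≤ χ := le_max_left _ _
  have χ1 : χ ≤ 1 := max_le zero_le_one (min_le_left _ _)
  have k0 : 0 ≤ k := le_max_left _ _
  have k1 : k ≤ 1 := max_le zero_le_one (min_le_left _ _)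
  have hχk : χ * k ≤ 1 := mul_le_one₀ χ1 k0 k1
  have e0 := Real.exp_pos (-x * y.2)
  have e1 : Real.exp (-x * y.2) ≤ 1 := Real.exp_le_one_iff.2 (by nlinarith)
  have hd : Real.exp (-x * y.2) - χ * k * Real.exp (-x * y.2) =
    (1 - χ * k) * Real.exp (-x * y.2) := by ring
  rw [hd, abs_of_nonneg (mul_nonneg (by linarith) e0.le)]
  have hle : (1 - χ * k) * Real.exp (-x * y.2) ≤ 1 :=
    mul_le_one₀ (by nlinarith [mul_nonneg χ0 k0]) e0.le e1
  by_cases h2 : y.1 < 1 + δ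
  · have : {y : ℝ × ℝ | 1 < y.1 ∧ y.1 < 1 + δ}.indicator (1 : ℝ × ℝ → ℝ) y = 1 :=
      Set.indicator_of_mem (show y ∈ {y : ℝ × ℝ | 1 < y.1 ∧ y.1 < 1 + δ} from ⟨h1, h2⟩) _
    linarith
  by_cases h3 : R < y.1
  · have : {y : ℝ × ℝ | R < y.1}.indicator (1 : ℝ × ℝ → ℝ) y = 1 :=
      Set.indicator_of_mem (show y ∈ {y : ℝ × ℝ | R < y.1} from h3) _
    linarith
  have hχe : χ = 1 := by
    refine le_antisymm χ1 (le_max_of_le_right (le_min le_rfl (le_min ?_ (by linarith))))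
    rw [le_div_iff₀ hδ]; linarith
  by_cases h4 : y.2 ≤ K
  · have hke : k = 1 := le_antisymm k1 (le_max_of_le_right (le_min le_rfl (by linarith)))
    rw [hχe, hke]
    linarith
  · have : {y : ℝ × ℝ | 1 < y.1}.indicator (1 : ℝ × ℝ → ℝ) y = 1 :=
      Set.indicator_of_mem (show y ∈ {y : ℝ × ℝ | 1 < y.1} from h1) _
    rw [this, mul_one]
    have h5 : Real.exp (-x * y.2) ≤ Real.exp (-x * K) := Real.exp_le_exp.2 (by nlinarith)
    have h6 : (1 - χ * k) * Real.exp (-x * y.2) ≤ Real.exp (-x * y.2) :=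
      mul_le_of_le_one_left e0.le (by linarith [mul_nonneg χ0 k0])
    linarith

theorem integrableOn_exp_neg_mul_snd {m : Measure (ℝ × ℝ)} (hm : m {y | 1 < y.1} ≠ ⊤) {x : ℝ}
    (hx : 0 ≤ x) :
    IntegrableOn (fun y : ℝ × ℝ => Real.exp (-x * y.2)) {y | 1 < y.1 ∧ 0 ≤ y.2} m := by
  have hS : MeasurableSet {y : ℝ × ℝ | 1 < y.1 ∧ 0 ≤ y.2} :=
    (measurableSet_lt measurable_const measurable_fst).inter
      (measurableSet_le measurable_const measurable_snd)
  refine Measure.integrableOn_of_bounded (M := 1)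
    (ne_top_of_le_ne_top hm (measure_mono fun y hy => hy.1)) ?_ ?_
  · exact (by fun_prop : Measurable fun y : ℝ × ℝ => Real.exp (-x * y.2)).aestronglyMeasurable
  · refine (ae_restrict_iff' hS).2 (Eventually.of_forall fun y hy => ?_)
    rw [Real.norm_of_nonneg (Real.exp_pos _).le]
    exact Real.exp_le_one_iff.2 (by nlinarith [hy.2])

/-- The measure is arbitrary because the estimate serves twice: for `μ` and for the law of the
rescaled vector. -/
theorem abs_setIntegral_exp_sub_integral_expCutoff_le {m : Measure (ℝ × ℝ)}
    (hm0 : m {y | y.2 < 0} = 0) (hm : m {y | 1 < y.1} ≠ ⊤) {x δ R K : ℝ} (hx : 0 < x) (hδ : 0 < δ)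
    (hR : 1 ≤ R) (hf : Integrable (expCutoff x δ R K) m) :
    |∫ y in {y : ℝ × ℝ | 1 < y.1 ∧ 0 ≤ y.2}, Real.exp (-x * y.2) ∂m -
        ∫ y, expCutoff x δ R K y ∂m| ≤
      m.real {y | 1 < y.1 ∧ y.1 < 1 + δ} + m.real {y | R < y.1} +
        Real.exp (-x * K) * m.real {y | 1 < y.1} := by
  have hS : MeasurableSet {y : ℝ × ℝ | 1 < y.1 ∧ 0 ≤ y.2} :=
    (measurableSet_lt measurable_const measurable_fst).inter
      (measurableSet_le measurable_const measurable_snd)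
  have m1 : MeasurableSet {y : ℝ × ℝ | 1 < y.1 ∧ y.1 < 1 + δ} :=
    (measurableSet_lt measurable_const measurable_fst).inter
      (measurableSet_lt measurable_fst measurable_const)
  have m2 : MeasurableSet {y : ℝ × ℝ | R < y.1} := measurableSet_lt measurable_const measurable_fst
  have m3 : MeasurableSet {y : ℝ × ℝ | 1 < y.1} := measurableSet_lt measurable_const measurable_fst
  have i1 : Integrable ({y : ℝ × ℝ | 1 < y.1 ∧ y.1 < 1 + δ}.indicator (1 : ℝ × ℝ → ℝ)) m :=
    (integrable_indicator_iff m1).2 (integrableOn_const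
      (ne_top_of_le_ne_top hm (measure_mono fun y hy => hy.1)))
  have i2 : Integrable ({y : ℝ × ℝ | R < y.1}.indicator (1 : ℝ × ℝ → ℝ)) m :=
    (integrable_indicator_iff m2).2 (integrableOn_const
      (ne_top_of_le_ne_top hm (measure_mono fun y (hy : R < y.1) => hR.trans_lt hy)))
  have i3 : Integrable ({y : ℝ × ℝ | 1 < y.1}.indicator (1 : ℝ × ℝ → ℝ)) m :=
    (integrable_indicator_iff m3).2 (integrableOn_const hm)
  rw [← integral_indicator hS, ← integral_sub
    ((integrable_indicator_iff hS).2 (integrableOn_exp_neg_mul_snd hm hx.le)) hf,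
    ← integral_indicator_one m1, ← integral_indicator_one m2, ← integral_indicator_one m3,
    ← integral_const_mul, ← integral_add i1 i2, ← integral_add (by exact i1.add i2) (i3.const_mul _)]
  refine (abs_integral_le_integral_abs).trans (integral_mono_of_nonneg
    (Eventually.of_forall fun y => abs_nonneg _) ((i1.add i2).add (i3.const_mul _)) ?_)
  have hae : ∀ᵐ y ∂m, 0 ≤ y.2 := by
    rw [ae_iff]; simpa using hm0
  filter_upwards [hae] with y hy
  exact abs_indicator_exp_sub_expCutoff_le hx hδ y hy

section Vector

variable {Ω : Type*} [MeasurableSpace Ω] {P : Measure Ω} {A B : Ω → ℝ}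
  {α : ℝ} {V : ℝ → ℝ} {μ : Measure (ℝ × ℝ)} {c : ℝ}

theorem RegularlyVaryingFunction.tendsto_measure_mul_div (hV : RegularlyVaryingFunction V (-α))
    (hA : Tendsto (fun x => P.real {ω | x < A ω} / V x) atTop (𝓝 c)) {a : ℝ} (ha : 0 < a) :
    Tendsto (fun x => P.real {ω | x * a < A ω} / V x) atTop (𝓝 (c * a ^ (-α))) := by
  have h1 := hA.comp (tendsto_id.atTop_mul_const ha)
  refine (h1.mul (hV.tendsto a ha)).congr' ?_
  filter_upwards [eventually_gt_atTop 0] with x hx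
  have := hV.pos (x * a) (mul_pos hx ha)
  simp only [Function.comp_apply, id]
  rw [div_mul_div_cancel₀ this.ne']

variable [IsProbabilityMeasure P]

theorem RegularlyVaryingVector.measure_lt_fst_le
    (hX : RegularlyVaryingVector P (fun ω => (A ω, B ω)) α V μ) (hAm : Measurable A)
    (hBm : Measurable B) (hA : Tendsto (fun x => P.real {ω | x < A ω} / V x) atTop (𝓝 c)) {a : ℝ}
    (ha : 0 < a) : μ {y | a < y.1} ≤ ENNReal.ofReal (c * a ^ (-α)) := by
  refine hX.measure_isOpen_le (hAm.prodMk hBm) (isOpen_lt continuous_const continuous_fst)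
    (by simp [ha.le]) ?_ (hX.regularlyVarying.tendsto_measure_mul_div hA ha)
  filter_upwards [eventually_gt_atTop 0] with x hx
  refine measureReal_mono fun ω hω => ?_
  have hω : a < x⁻¹ * A ω := hω
  rwa [← div_eq_inv_mul, lt_div_iff₀ hx, mul_comm] at hω

theorem measureReal_lt_and_lt_le (hAm : Measurable A) {x b : ℝ} (hxb : x ≤ b) :
    P.real {ω | x < A ω ∧ A ω < b} ≤ P.real {ω | x < A ω} - P.real {ω | b < A ω} := by
  rw [← measureReal_sdiff (s₁ := {ω | x < A ω}) (s₂ := {ω | b < A ω})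
    (fun ω (h : b < A ω) => hxb.trans_lt h) (measurableSet_lt measurable_const hAm)]
  exact measureReal_mono fun ω hω => ⟨hω.1, not_lt.2 hω.2.le⟩

/-- The bound vanishes as `b → 1`, which controls the ramp of the cutoff near the discontinuity at
`y.1 = 1`. -/
theorem RegularlyVaryingVector.measure_lt_fst_lt_le
    (hX : RegularlyVaryingVector P (fun ω => (A ω, B ω)) α V μ) (hAm : Measurable A)
    (hBm : Measurable B) (hA : Tendsto (fun x => P.real {ω | x < A ω} / V x) atTop (𝓝 c)) {b : ℝ}
    (hb : 1 < b) : μ {y | 1 < y.1 ∧ y.1 < b} ≤ ENNReal.ofReal (c - c * b ^ (-α)) := by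
  refine hX.measure_isOpen_le (hAm.prodMk hBm)
    ((isOpen_lt continuous_const continuous_fst).inter
      (isOpen_lt continuous_fst continuous_const))
    (fun h => by have : (1 : ℝ) < 0 := h.1; linarith) ?_
    ((hA.sub (hX.regularlyVarying.tendsto_measure_mul_div hA (zero_lt_one.trans hb))).congr
      fun x => (sub_div _ _ _).symm)
  filter_upwards [eventually_gt_atTop 0] with x hx
  refine le_trans (measureReal_mono fun ω hω => ?_)
    (measureReal_lt_and_lt_le hAm (le_mul_of_one_le_right hx.le hb.le))
  have h1 : 1 < x⁻¹ * A ω := hω.1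
  have h2 : x⁻¹ * A ω < b := hω.2
  rw [← div_eq_inv_mul] at h1 h2
  rw [lt_div_iff₀ hx] at h1
  rw [div_lt_iff₀ hx] at h2
  exact ⟨by linarith, by linarith⟩

theorem RegularlyVaryingVector.measure_snd_neg
    (hX : RegularlyVaryingVector P (fun ω => (A ω, B ω)) α V μ) (hAm : Measurable A)
    (hBm : Measurable B) (hB0 : ∀ ω, 0 ≤ B ω) : μ {y | y.2 < 0} = 0 := by
  have := hX.measure_isOpen_le (hAm.prodMk hBm) (U := {y | y.2 < 0}) (g := fun _ => 0) (c := 0)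
    (isOpen_lt continuous_snd continuous_const) (by simp) ?_ (by simp)
  · simpa using this
  filter_upwards [eventually_gt_atTop 0] with x hx
  refine le_of_eq ?_
  convert measureReal_empty (μ := P)
  ext ω
  simp only [Set.mem_ofPred_eq, Prod.smul_snd, smul_eq_mul, Set.mem_empty_iff_false, iff_false,
    not_lt]
  have := hB0 ω
  positivity

/-- The integrand is discontinuous at `y.1 = 1` and has unbounded support, so vague convergence is
applied to `expCutoff`. The cutoff errors for `μ` and, in the limit, for the rescaled law obey the
same bound, governed by the tail of `A` alone. -/
theorem RegularlyVaryingVector.tendsto_setIntegral_exp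
    (hX : RegularlyVaryingVector P (fun ω => (A ω, B ω)) α V μ) (hAm : Measurable A)
    (hBm : Measurable B) (hB0 : ∀ ω, 0 ≤ B ω) (hα : 0 < α) (hc : 0 ≤ c)
    (hA : Tendsto (fun x => P.real {ω | x < A ω} / V x) atTop (𝓝 c)) {x : ℝ} (hx : 0 < x) :
    Tendsto (fun r => (∫ ω in {ω | r < A ω}, Real.exp (-x * (B ω / r)) ∂P) / V r) atTop
      (𝓝 (∫ y in {y : ℝ × ℝ | 1 < y.1 ∧ 0 ≤ y.2}, Real.exp (-x * y.2) ∂μ)) := by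
  have hXm : Measurable fun ω => (A ω, B ω) := hAm.prodMk hBm
  have hS : MeasurableSet {y : ℝ × ℝ | 1 < y.1 ∧ 0 ≤ y.2} :=
    (measurableSet_lt measurable_const measurable_fst).inter
      (measurableSet_le measurable_const measurable_snd)
  have hV := hX.regularlyVarying
  -- The cutoff error for `δ = 1 / (n + 1)` and `R = K = n + 1`.
  set β : ℕ → ℝ := fun n => (c - c * (1 + 1 / ((n : ℝ) + 1)) ^ (-α)) + c * ((n : ℝ) + 1) ^ (-α) +
    Real.exp (-x * ((n : ℝ) + 1)) * c with hβ
  have hβ0 : Tendsto β atTop (𝓝 0) := by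
    have hn : Tendsto (fun n : ℕ => (n : ℝ) + 1) atTop atTop :=
      tendsto_natCast_atTop_atTop.atTop_add tendsto_const_nhds
    have h1 : Tendsto (fun n : ℕ => (1 + 1 / ((n : ℝ) + 1)) ^ (-α)) atTop (𝓝 1) := by
      have := (tendsto_one_div_add_atTop_nhds_zero_nat (𝕜 := ℝ)).const_add 1
      rw [add_zero] at this
      have h2 := (Real.continuousAt_rpow_const 1 (-α) (Or.inl one_ne_zero)).tendsto.comp this
      rwa [Real.one_rpow] at h2
    have h2 : Tendsto (fun n : ℕ => ((n : ℝ) + 1) ^ (-α)) atTop (𝓝 0) :=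
      (tendsto_rpow_neg_atTop hα).comp hn
    have h3 : Tendsto (fun n : ℕ => Real.exp (-x * ((n : ℝ) + 1))) atTop (𝓝 0) :=
      Real.tendsto_exp_atBot.comp (hn.const_mul_atTop_of_neg (by linarith))
    have := (((h1.const_mul c).const_sub c).add (h2.const_mul c)).add (h3.mul_const c)
    simpa only [mul_zero, mul_one, sub_self, zero_mul, add_zero] using this
  rw [Metric.tendsto_nhds]
  intro ε hε
  obtain ⟨n, hn⟩ := (hβ0.eventually_lt_const (show 0 < ε / 4 by linarith)).exists
  set δ : ℝ := 1 / ((n : ℝ) + 1) with hδdef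
  set R : ℝ := (n : ℝ) + 1 with hRdef
  have hR : 1 ≤ R := by rw [hRdef]; linarith [n.cast_nonneg (α := ℝ)]
  have hδ : 0 < δ := by rw [hδdef]; positivity
  have hfc := continuous_expCutoff x δ R R
  have hcs := hasCompactSupport_expCutoff x hδ R R
  have h0f := zero_notMem_tsupport_expCutoff x hδ R R
  have hRα : 0 ≤ c * R ^ (-α) := by positivity
  have hδα : 0 ≤ c - c * (1 + δ) ^ (-α) := by
    have : (1 + δ) ^ (-α) ≤ 1 := Real.rpow_le_one_of_one_le_of_nonpos (by linarith) (by linarith)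
    nlinarith
  have hμ1 : μ {y | 1 < y.1} ≤ ENNReal.ofReal c := by
    simpa using hX.measure_lt_fst_le hAm hBm hA one_pos
  have hμle : |∫ y in {y : ℝ × ℝ | 1 < y.1 ∧ 0 ≤ y.2}, Real.exp (-x * y.2) ∂μ -
        ∫ y, expCutoff x δ R R y ∂μ| ≤ β n := by
    refine (abs_setIntegral_exp_sub_integral_expCutoff_le (hX.measure_snd_neg hAm hBm hB0)
      (ne_top_of_le_ne_top ENNReal.ofReal_ne_top hμ1) hx hδ hR
      (hX.radon.integrable hfc hcs h0f)).trans ?_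
    refine add_le_add (add_le_add ?_ ?_) (mul_le_mul_of_nonneg_left ?_ (Real.exp_pos _).le)
    · exact ENNReal.toReal_le_of_le_ofReal hδα
        (hX.measure_lt_fst_lt_le hAm hBm hA (by linarith))
    · exact ENNReal.toReal_le_of_le_ofReal hRα
        (hX.measure_lt_fst_le hAm hBm hA (by linarith))
    · exact ENNReal.toReal_le_of_le_ofReal hc hμ1
  have hPlim : Tendsto (fun r => ((P.real {ω | r < A ω} - P.real {ω | r * (1 + δ) < A ω}) +
      P.real {ω | r * R < A ω} + Real.exp (-x * R) * P.real {ω | r < A ω}) / V r) atTop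
      (𝓝 (β n)) := by
    have h1 := hV.tendsto_measure_mul_div hA (by linarith : 0 < 1 + δ)
    have h2 := hV.tendsto_measure_mul_div hA (by linarith : 0 < R)
    refine (((hA.sub h1).add h2).add (hA.const_mul (Real.exp (-x * R)))).congr fun r => ?_
    ring
  have hPle : ∀ r, 0 < r → |(∫ ω in {ω | r < A ω}, Real.exp (-x * (B ω / r)) ∂P) -
      ∫ ω, expCutoff x δ R R (r⁻¹ • (A ω, B ω)) ∂P| ≤
      (P.real {ω | r < A ω} - P.real {ω | r * (1 + δ) < A ω}) +
      P.real {ω | r * R < A ω} + Real.exp (-x * R) * P.real {ω | r < A ω} := by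
    intro r hr
    have hYm : Measurable fun ω => r⁻¹ • (A ω, B ω) :=
      (measurable_const_smul r⁻¹).comp hXm
    have hmap : ∀ a : ℝ, (P.map fun ω => r⁻¹ • (A ω, B ω)).real {y | a < y.1} =
        P.real {ω | r * a < A ω} := by
      intro a
      rw [map_measureReal_apply hYm (measurableSet_lt measurable_const measurable_fst)]
      congr 1; ext ω
      simp only [Set.mem_preimage, Set.mem_ofPred_eq, Prod.smul_fst, smul_eq_mul]
      rw [← div_eq_inv_mul, lt_div_iff₀ hr, mul_comm]
    have hprob : IsProbabilityMeasure (P.map fun ω => r⁻¹ • (A ω, B ω)) :=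
      Measure.isProbabilityMeasure_map hYm.aemeasurable
    have hfi : Integrable (expCutoff x δ R R) (P.map fun ω => r⁻¹ • (A ω, B ω)) :=
      hfc.integrable_of_hasCompactSupport hcs
    have hneg : (P.map fun ω => r⁻¹ • (A ω, B ω)) {y | y.2 < 0} = 0 := by
      rw [Measure.map_apply hYm (measurableSet_lt measurable_snd measurable_const)]
      convert measure_empty (μ := P)
      ext ω
      simp only [Set.mem_preimage, Set.mem_ofPred_eq, Prod.smul_snd, smul_eq_mul,
        Set.mem_empty_iff_false, iff_false, not_lt]
      have := hB0 ω
      positivity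
    have hmain := abs_setIntegral_exp_sub_integral_expCutoff_le hneg (measure_ne_top _ _) (K := R) hx hδ
      hR hfi
    rw [hmap, hmap, mul_one, setIntegral_map hS
      (by fun_prop : Measurable fun y : ℝ × ℝ => Real.exp (-x * y.2)).aestronglyMeasurable
      hYm.aemeasurable, integral_map hYm.aemeasurable hfc.aestronglyMeasurable] at hmain
    have hset : (fun ω => r⁻¹ • (A ω, B ω)) ⁻¹' {y : ℝ × ℝ | 1 < y.1 ∧ 0 ≤ y.2} =
        {ω | r < A ω} := by
      ext ω
      simp only [Set.mem_preimage, Set.mem_ofPred_eq, Prod.smul_fst, Prod.smul_snd, smul_eq_mul]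
      have := hB0 ω
      rw [← div_eq_inv_mul, lt_div_iff₀ hr, one_mul]
      exact and_iff_left (by positivity)
    rw [hset] at hmain
    simp only [Prod.smul_snd, smul_eq_mul, ← div_eq_inv_mul] at hmain
    refine hmain.trans (add_le_add (add_le_add ?_ le_rfl) le_rfl)
    have hms : MeasurableSet {y : ℝ × ℝ | 1 < y.1 ∧ y.1 < 1 + δ} :=
      (measurableSet_lt measurable_const measurable_fst).inter
        (measurableSet_lt measurable_fst measurable_const)
    rw [map_measureReal_apply hYm hms]
    refine le_trans (le_of_eq ?_) (measureReal_lt_and_lt_le hAm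
      (le_mul_of_one_le_right hr.le (by linarith : 1 ≤ 1 + δ)))
    congr 1; ext ω
    simp only [Set.mem_preimage, Set.mem_ofPred_eq, Prod.smul_fst, smul_eq_mul]
    rw [← div_eq_inv_mul, lt_div_iff₀ hr, div_lt_iff₀ hr, one_mul, mul_comm r]
  have hvag := hX.vague _ hfc hcs h0f (expCutoff_nonneg x δ R R)
  rw [Metric.tendsto_nhds] at hvag
  filter_upwards [eventually_gt_atTop 0, hPlim.eventually_lt_const hn,
    hvag (ε / 4) (by linarith)] with r hr h1 h2
  have hVr := hV.pos r hr
  -- Three errors, each below `ε / 4`: the cutoff under the rescaled law, vague convergence, and the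
  -- cutoff under `μ`.
  rw [Real.dist_eq] at h2 ⊢
  have h3 := div_le_div_of_nonneg_right (hPle r hr) hVr.le
  rw [← abs_of_pos hVr, ← abs_div, abs_of_pos hVr, sub_div] at h3
  rw [abs_lt] at h2 ⊢
  rw [abs_le] at h3 hμle
  constructor <;> linarith [h3.1, h3.2, h2.1, h2.2, hμle.1, hμle.2]

end Vector

/-! ### The fixed-point equation for the distribution function. -/

section MaxEquation

variable {Ω Ω' : Type*} [MeasurableSpace Ω] [MeasurableSpace Ω'] {P : Measure Ω} {P' : Measure Ω'}
  {νt : Ω → ℝ≥0} {ν : Ω → ℕ} {Mk : ℕ → Ω → ℝ≥0} {M : Ω' → ℝ≥0}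

/-- Split according to the value `n` of `ν`: the event that the first `n` copies are at most `r` is
independent of `(νt, ν)` and has probability `F ^ n`. -/
theorem SolvesMaxEquation.measure_le_eq_lintegral (hM : SolvesMaxEquation P P' νt ν Mk M)
    (hνt : Measurable νt) (hν : Measurable ν) (r : ℝ≥0) :
    P' {ω | M ω ≤ r} = ∫⁻ ω in {ω | νt ω ≤ r}, P' {ω | M ω ≤ r} ^ ν ω ∂P := by
  set F := P' {ω | M ω ≤ r} with hF
  have hmax : F = P {ω | max (νt ω) ((Finset.Icc 1 (ν ω)).sup fun k => Mk k ω) ≤ r} :=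
    hM.identDistrib_max.measure_mem_eq (s := Set.Iic r) measurableSet_Iic
  set A : ℕ → Set Ω := fun n => {ω | νt ω ≤ r ∧ ν ω = n} with hA
  set B : ℕ → Set Ω := fun n => {ω | ∀ k ∈ Finset.Icc 1 n, Mk k ω ≤ r} with hB
  have hun : {ω | max (νt ω) ((Finset.Icc 1 (ν ω)).sup fun k => Mk k ω) ≤ r} =
      ⋃ n, A n ∩ B n := by
    ext ω
    simp [hA, hB, Finset.sup_le_iff]
  have hBeq : ∀ n, B n = ⋂ k ∈ Finset.Icc 1 n, Mk k ⁻¹' Set.Iic r := by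
    intro n; ext ω; simp [hB]
  have hAm : ∀ n, MeasurableSet (A n) := fun n =>
    (measurableSet_le hνt measurable_const).inter (hν (measurableSet_singleton n))
  have hBm : ∀ n, NullMeasurableSet (B n) P := by
    intro n
    rw [hBeq]
    exact NullMeasurableSet.biInter (Finset.countable_toSet _) fun k _ =>
      (hM.identDistrib_copy k).aemeasurable_fst.nullMeasurableSet_preimage measurableSet_Iic
  have hPB : ∀ n, P (B n) = F ^ n := by
    intro n
    rw [hBeq, hM.iIndep.measure_inter_preimage_eq_mul _ fun _ _ => measurableSet_Iic]
    rw [Finset.prod_congr rfl fun k _ =>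
      (hM.identDistrib_copy k).measure_mem_eq (s := Set.Iic r) measurableSet_Iic]
    -- `Finset.Icc 1 n` has exactly `n` elements; for `n = 0` the empty product `1` agrees with the
    -- empty maximum `0 ≤ r`.
    rw [Finset.prod_const, Nat.card_Icc, Nat.add_sub_cancel]
    rfl
  have hPAB : ∀ n, P (A n ∩ B n) = P (A n) * P (B n) := by
    intro n
    refine hM.indep.measure_inter_preimage_eq_mul (Set.Iic r ×ˢ {n})
      {m : ℕ → ℝ≥0 | ∀ k ∈ Finset.Icc 1 n, m k ≤ r}
      (measurableSet_Iic.prod (measurableSet_singleton n)) ?_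
    have : {m : ℕ → ℝ≥0 | ∀ k ∈ Finset.Icc 1 n, m k ≤ r} =
        ⋂ k ∈ Finset.Icc 1 n, {m : ℕ → ℝ≥0 | m k ≤ r} := by
      ext m; simp
    rw [this]
    exact Finset.measurableSet_biInter _ fun k _ =>
      measurableSet_le (measurable_pi_apply k) measurable_const
  have hdisj : Pairwise (Function.onFun (AEDisjoint P) fun n => A n ∩ B n) := by
    intro m n hmn
    refine Disjoint.aedisjoint (Set.disjoint_left.2 fun ω h1 h2 => hmn ?_)
    exact h1.1.2.symm.trans h2.1.2
  have hmap : ∫⁻ ω in {ω | νt ω ≤ r}, F ^ ν ω ∂P =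
      ∫⁻ n, F ^ n ∂((P.restrict {ω | νt ω ≤ r}).map ν) :=
    (lintegral_map (f := fun n => F ^ n) measurable_from_nat hν).symm
  have hFsum : F = ∑' n, P (A n ∩ B n) := by
    rw [← measure_iUnion₀ hdisj fun n => (hAm n).nullMeasurableSet.inter (hBm n), ← hun, hmax]
  rw [hmap, lintegral_countable']
  refine hFsum.trans ?_
  refine tsum_congr fun n => ?_
  rw [hPAB, hPB, Measure.map_apply hν (measurableSet_singleton n),
    Measure.restrict_apply (hν (measurableSet_singleton n)), mul_comm, Set.inter_comm]
  rfl

/-- The distribution function of a solution of the max-equation is a fixed point. -/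
theorem SolvesMaxEquation.one_sub_tail_eq [IsProbabilityMeasure P'] [IsProbabilityMeasure P]
    (hM : SolvesMaxEquation P P' νt ν Mk M)
    (hνt : Measurable νt) (hν : Measurable ν) {r : ℝ} (hr : 0 ≤ r) :
    1 - P'.real {ω | r < (M ω : ℝ)} =
      ∫ ω in {ω | (νt ω : ℝ) ≤ r}, (1 - P'.real {ω | r < (M ω : ℝ)}) ^ ν ω ∂P := by
  lift r to ℝ≥0 using hr
  have hms : NullMeasurableSet {ω | M ω ≤ r} P' :=
    hM.identDistrib_max.aemeasurable_fst.nullMeasurableSet_preimage measurableSet_Iic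
  have hcompl : 1 - P'.real {ω | (r : ℝ) < (M ω : ℝ)} = P'.real {ω | M ω ≤ r} := by
    have h1 : {ω | (r : ℝ) < (M ω : ℝ)} = {ω | M ω ≤ r}ᶜ := by
      ext ω; simp
    rw [h1, probReal_compl_eq_one_sub₀ hms]; ring
  have h2 : {ω | (νt ω : ℝ) ≤ r} = {ω | νt ω ≤ r} := by ext ω; simp
  rw [hcompl, h2, integral_eq_lintegral_of_nonneg_ae
    (Eventually.of_forall fun ω => pow_nonneg measureReal_nonneg _)
    ((measurable_from_nat (f := fun n => P'.real {ω | M ω ≤ r} ^ n)).comp hν).aestronglyMeasurable]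
  rw [Measure.real, hM.measure_le_eq_lintegral hνt hν r]
  congr 1
  refine lintegral_congr fun ω => ?_
  rw [← hM.measure_le_eq_lintegral hνt hν r, ENNReal.ofReal_pow ENNReal.toReal_nonneg,
    ENNReal.ofReal_toReal (measure_ne_top _ _)]

end MaxEquation

/-! ### Monotonicity and asymptotics of the defect. -/

section Tail

variable {Ω : Type*} [MeasurableSpace Ω] {P : Measure Ω} {ν : Ω → ℕ}
  {A : Ω → ℝ} {α : ℝ} {V : ℝ → ℝ} {μ : Measure (ℝ × ℝ)} {c₁ c₂ : ℝ}

theorem setIntegral_natCast_le_one (hmean : ∫ ω, (ν ω : ℝ) ∂P = 1) (T : Set Ω) :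
    ∫ ω in T, (ν ω : ℝ) ∂P ≤ 1 := by
  rw [← hmean]
  exact setIntegral_le_integral (integrable_of_integral_eq_one hmean)
    (Eventually.of_forall fun ω => Nat.cast_nonneg _)

variable [IsProbabilityMeasure P]

theorem integrable_one_sub_pow (hν : Measurable ν) {s : ℝ} (hs : 0 ≤ s) (hs1 : s ≤ 1) :
    Integrable (fun ω => (1 - s) ^ ν ω) P := by
  refine Integrable.of_bound
    ((measurable_from_nat (f := fun n => (1 - s) ^ n)).comp hν).aestronglyMeasurable 1
    (Eventually.of_forall fun ω => ?_)
  rw [Real.norm_of_nonneg (pow_nonneg (by linarith) _)]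
  exact pow_le_one₀ (by linarith) (by linarith)

/-- Raising `s` to `t` lowers the integral by at most `E[ν; T] * (t - s) ≤ t - s`, while `-(1 - s)`
rises by `t - s`. This is where criticality, `E ν = 1`, makes the defect monotone. -/
theorem setIntegral_one_sub_pow_sub_mono (hν : Measurable ν) (hmean : ∫ ω, (ν ω : ℝ) ∂P = 1)
    (T : Set Ω) {s t : ℝ} (hs : 0 ≤ s) (hst : s ≤ t) (ht : t ≤ 1) :
    ∫ ω in T, (1 - s) ^ ν ω ∂P - (1 - s) ≤ ∫ ω in T, (1 - t) ^ ν ω ∂P - (1 - t) := by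
  have hi := integrable_of_integral_eq_one hmean
  have i1 := (integrable_one_sub_pow (P := P) hν hs (hst.trans ht)).integrableOn (s := T)
  have i2 := (integrable_one_sub_pow (P := P) hν (hs.trans hst) ht).integrableOn (s := T)
  have h1 : ∫ ω in T, (1 - s) ^ ν ω ∂P - ∫ ω in T, (1 - t) ^ ν ω ∂P ≤
      ∫ ω in T, (ν ω : ℝ) * (t - s) ∂P := by
    rw [← integral_sub i1 i2]
    refine integral_mono (i1.sub i2) (hi.integrableOn.mul_const _) fun ω => ?_
    have := pow_sub_pow_le_nat_mul_sub (a := 1 - s) (b := 1 - t) (by linarith) (by linarith)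
      (by linarith) (ν ω)
    simpa using this
  rw [integral_mul_const] at h1
  have := mul_le_mul_of_nonneg_right (setIntegral_natCast_le_one (P := P) hmean T)
    (by linarith : 0 ≤ t - s)
  linarith

theorem tendsto_fixedPoint_defect_div
    (hX : RegularlyVaryingVector P (fun ω => (A ω, (ν ω : ℝ))) α V μ)
    (hVanti : Antitone V) (hV1 : ∀ x, V x ≤ 1) (hAm : Measurable A) (hν : Measurable ν)
    (hmean : ∫ ω, (ν ω : ℝ) ∂P = 1) (hα₁ : 1 < α) (hα₂ : α < 2)
    (hc₁ : 0 < c₁) (hc₂ : 0 < c₂)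
    (hlim₁ : Tendsto (fun x : ℝ => P.real {ω | x < (ν ω : ℝ)} / V x) atTop (𝓝 c₁))
    (hlim₂ : Tendsto (fun x : ℝ => P.real {ω | x < A ω} / V x) atTop (𝓝 c₂)) {x : ℝ} (hx : 0 < x) :
    Tendsto (fun r => (∫ ω in {ω | A ω ≤ r}, (1 - x / r) ^ ν ω ∂P - (1 - x / r)) / V r) atTop
      (𝓝 (c₁ * α * Real.Gamma (-α) * x ^ α -
        ∫ y in {y : ℝ × ℝ | 1 < y.1 ∧ 0 ≤ y.2}, Real.exp (-x * y.2) ∂μ)) := by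
  have hV := hX.regularlyVarying
  have hVpos : ∀ x, 0 < V x := fun x =>
    (hV.pos (max x 1) (by positivity)).trans_le (hVanti (le_max_left _ _))
  have hi := integrable_of_integral_eq_one hmean
  have hνm : Measurable fun ω => (ν ω : ℝ) := measurable_from_nat.comp hν
  -- A positive limit `c₁` makes the tail of `ν` positive at arbitrarily large points, hence
  -- everywhere by monotonicity.
  have hUpos : ∀ x, 0 < P.real {ω | x < (ν ω : ℝ)} := by
    intro x
    obtain ⟨z, hz, hzx⟩ := ((hlim₁.eventually_const_lt hc₁).and (eventually_ge_atTop x)).exists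
    have h1 : 0 < P.real {ω | z < (ν ω : ℝ)} := by
      by_contra! h
      exact absurd hz (not_lt.2 (div_nonpos_of_nonpos_of_nonneg h (hVpos z).le))
    exact h1.trans_le (measureReal_mono fun ω (h : z < (ν ω : ℝ)) => hzx.trans_lt h)
  have hURV : ∀ y : ℝ, 0 < y → Tendsto (fun x => P.real {ω | x * y < (ν ω : ℝ)} /
      P.real {ω | x < (ν ω : ℝ)}) atTop (𝓝 (y ^ (-α))) := by
    intro y hy
    have := (hV.tendsto_measure_mul_div hlim₁ hy).div hlim₁ hc₁.ne'
    rw [mul_div_cancel_left₀ _ hc₁.ne'] at this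
    exact this.congr fun z => div_div_div_cancel_right₀ (hVpos z).ne' _ _
  -- The Laplace asymptotics at scale `r / x`; the factor `x ^ α` comes from comparing the tail of
  -- `ν` there with `V r`.
  have hmain : Tendsto (fun r => (∫ ω, (Real.exp (-((ν ω : ℝ) / (r * x⁻¹))) - 1 +
      (ν ω : ℝ) / (r * x⁻¹)) ∂P) / V r) atTop (𝓝 (c₁ * α * Real.Gamma (-α) * x ^ α)) := by
    have hx' : 0 < x⁻¹ := inv_pos.2 hx
    have h1 := (tendsto_integral_exp_neg_sub_one_add_div P hνm (fun ω => Nat.cast_nonneg _) hα₁ hα₂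
      hUpos hURV).comp (tendsto_id.atTop_mul_const hx')
    have h2 := h1.mul (hV.tendsto_measure_mul_div hlim₁ hx')
    rw [Real.inv_rpow hx.le, Real.rpow_neg hx.le, inv_inv,
      show α * Real.Gamma (-α) * (c₁ * x ^ α) = c₁ * α * Real.Gamma (-α) * x ^ α by ring] at h2
    refine h2.congr fun r => ?_
    simp only [Function.comp_apply, id]
    rw [div_mul_div_cancel₀ (hUpos _).ne']
  have hI := hX.tendsto_setIntegral_exp hAm hνm (fun ω => Nat.cast_nonneg _) (by linarith) hc₂.le
    hlim₂ hx
  have herr : Tendsto (fun r => (∫ ω in {ω | A ω ≤ r}, ((1 - x / r) ^ ν ω -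
      Real.exp (-x * ((ν ω : ℝ) / r))) ∂P) / V r) atTop (𝓝 0) := by
    have h0 := (tendsto_rpow_neg_two_div_zero hVanti hVpos hV1 (hV.tendsto 2 two_pos)
      hα₁ hα₂).const_mul (x ^ 2)
    rw [mul_zero] at h0
    refine squeeze_zero_norm' ?_ h0
    filter_upwards [eventually_ge_atTop x] with r hr
    have hr0 : 0 < r := hx.trans_le hr
    rw [norm_div, Real.norm_of_nonneg (hVpos r).le, ← mul_div_assoc]
    refine div_le_div_of_nonneg_right ?_ (hVpos r).le
    refine (norm_integral_le_of_norm_le (hi.integrableOn.mul_const ((x / r) ^ 2))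
      (Eventually.of_forall fun ω => ?_)).trans ?_
    · rw [Real.norm_eq_abs, abs_sub_comm,
        show -x * ((ν ω : ℝ) / r) = -(x / r) * (ν ω : ℝ) by ring]
      exact exp_neg_pow_sub_one_sub_pow_le (by positivity) (by rwa [div_le_one hr0]) (ν ω)
    · rw [integral_mul_const, ← inv_pow, ← mul_pow, ← div_eq_mul_inv]
      exact mul_le_of_le_one_left (by positivity) (setIntegral_natCast_le_one hmean _)
  have hsum := (hmain.sub hI).add herr
  rw [add_zero] at hsum
  refine hsum.congr' ?_
  filter_upwards [eventually_ge_atTop x] with r hr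
  have hr0 : 0 < r := hx.trans_le hr
  rw [← sub_div, ← add_div]
  congr 1
  have hexp : Integrable (fun ω => Real.exp (-x * ((ν ω : ℝ) / r))) P := by
    refine Integrable.of_bound (by fun_prop : Measurable fun ω =>
      Real.exp (-x * ((ν ω : ℝ) / r))).aestronglyMeasurable 1 (Eventually.of_forall fun ω => ?_)
    rw [Real.norm_of_nonneg (Real.exp_pos _).le]
    refine Real.exp_le_one_iff.2 ?_
    have : 0 ≤ x * ((ν ω : ℝ) / r) := by positivity
    linarith
  -- The mean of `x * ν / r` is `x / r`, which produces precisely the term `-(1 - x / r)` of the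
  -- defect.
  have e1 : ∫ ω, (Real.exp (-((ν ω : ℝ) / (r * x⁻¹))) - 1 + (ν ω : ℝ) / (r * x⁻¹)) ∂P =
      ∫ ω, Real.exp (-x * ((ν ω : ℝ) / r)) ∂P - 1 + x / r := by
    have h1 : ∀ ω, (ν ω : ℝ) / (r * x⁻¹) = x * ((ν ω : ℝ) / r) := fun ω => by
      field_simp
    simp only [h1, ← neg_mul]
    rw [integral_add (by exact hexp.sub (integrable_const _)) ((hi.div_const r).const_mul x),
      integral_sub hexp (integrable_const _), integral_const_mul, integral_div, hmean]
    simp [div_eq_mul_inv]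
  have hms : MeasurableSet {ω | A ω ≤ r} := measurableSet_le hAm measurable_const
  have hc : {ω | r < A ω} = {ω | A ω ≤ r}ᶜ := by ext ω; simp
  have e2 := integral_add_compl hms hexp
  rw [e1, ← e2, hc, integral_sub (integrable_one_sub_pow hν (by positivity)
    (by rwa [div_le_one hr0])).integrableOn hexp.integrableOn]
  ring

/-- For `K` large, `c₁ * K ^ (-α) < c₂`, so the event that `A > r` but `ν ≤ r * K` has probability
at least of order `V r`. On it the exponential is at least `exp (-K)`, and the bound survives the
limit. -/
theorem setIntegral_exp_pos
    (hX : RegularlyVaryingVector P (fun ω => (A ω, (ν ω : ℝ))) α V μ)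
    (hAm : Measurable A) (hν : Measurable ν) (hα₁ : 1 < α) (hc₂ : 0 < c₂)
    (hlim₁ : Tendsto (fun x : ℝ => P.real {ω | x < (ν ω : ℝ)} / V x) atTop (𝓝 c₁))
    (hlim₂ : Tendsto (fun x : ℝ => P.real {ω | x < A ω} / V x) atTop (𝓝 c₂)) :
    0 < ∫ y in {y : ℝ × ℝ | 1 < y.1 ∧ 0 ≤ y.2}, Real.exp (-1 * y.2) ∂μ := by
  have hV := hX.regularlyVarying
  have hνm : Measurable fun ω => (ν ω : ℝ) := measurable_from_nat.comp hν
  have h1 : Tendsto (fun K : ℝ => c₁ * K ^ (-α)) atTop (𝓝 (c₁ * 0)) :=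
    (tendsto_rpow_neg_atTop (by linarith)).const_mul _
  rw [mul_zero] at h1
  obtain ⟨K, hK, hK0⟩ := ((h1.eventually_lt_const hc₂).and (eventually_gt_atTop 0)).exists
  have hlow := ((hlim₂.sub (hV.tendsto_measure_mul_div hlim₁ hK0)).const_mul (Real.exp (-K)))
  have hI := hX.tendsto_setIntegral_exp hAm hνm (fun ω => Nat.cast_nonneg _) (by linarith) hc₂.le
    hlim₂ one_pos
  refine lt_of_lt_of_le (mul_pos (Real.exp_pos (-K)) (sub_pos.2 hK))
    (le_of_tendsto_of_tendsto hlow hI ?_)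
  filter_upwards [eventually_gt_atTop 0] with r hr
  rw [← sub_div, ← mul_div_assoc]
  refine div_le_div_of_nonneg_right ?_ (hV.pos r hr).le
  have hD : MeasurableSet ({ω | r < A ω} \ {ω | r * K < (ν ω : ℝ)}) :=
    (measurableSet_lt measurable_const hAm).diff (measurableSet_lt measurable_const hνm)
  have hexp : Integrable (fun ω => Real.exp (-1 * ((ν ω : ℝ) / r))) P := by
    refine Integrable.of_bound (by fun_prop : Measurable fun ω =>
      Real.exp (-1 * ((ν ω : ℝ) / r))).aestronglyMeasurable 1 (Eventually.of_forall fun ω => ?_)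
    rw [Real.norm_of_nonneg (Real.exp_pos _).le]
    refine Real.exp_le_one_iff.2 ?_
    have : 0 ≤ (ν ω : ℝ) / r := by positivity
    linarith
  calc Real.exp (-K) * (P.real {ω | r < A ω} - P.real {ω | r * K < (ν ω : ℝ)})
      ≤ Real.exp (-K) * P.real ({ω | r < A ω} \ {ω | r * K < (ν ω : ℝ)}) := by
        gcongr
        exact le_measureReal_sdiff
    _ = ∫ ω in {ω | r < A ω} \ {ω | r * K < (ν ω : ℝ)}, Real.exp (-K) ∂P := by
        rw [setIntegral_const, smul_eq_mul, mul_comm]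
    _ ≤ ∫ ω in {ω | r < A ω} \ {ω | r * K < (ν ω : ℝ)}, Real.exp (-1 * ((ν ω : ℝ) / r)) ∂P := by
        refine setIntegral_mono_on (integrableOn_const (measure_ne_top _ _)) hexp.integrableOn hD
          fun ω hω => Real.exp_le_exp.2 ?_
        have h2 : (ν ω : ℝ) ≤ r * K := not_lt.1 hω.2
        have h3 : (ν ω : ℝ) / r ≤ K := by rw [div_le_iff₀ hr]; linarith
        linarith
    _ ≤ _ := setIntegral_mono_set hexp.integrableOn
        (Eventually.of_forall fun ω => (Real.exp_pos _).le)
        (Eventually.of_forall fun ω hω => hω.1)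

end Tail

/-! ### The limiting equation for the constant. -/

theorem mul_Gamma_neg_pos {α : ℝ} (hα₁ : 1 < α) (hα₂ : α < 2) : 0 < α * Real.Gamma (-α) := by
  have hpos : 0 < Real.Gamma (2 - α) := Real.Gamma_pos_of_pos (by linarith)
  rw [Gamma_two_sub_eq hα₁, show (1 - α) * (-α * Real.Gamma (-α)) =
    (α - 1) * (α * Real.Gamma (-α)) by ring] at hpos
  exact pos_of_mul_pos_right hpos (by linarith)

theorem setIntegral_exp_neg_mul_snd_antitone {m : Measure (ℝ × ℝ)} (hm : m {y | 1 < y.1} ≠ ⊤)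
    {x x' : ℝ} (hx : 0 ≤ x) (hxx' : x ≤ x') :
    ∫ y in {y : ℝ × ℝ | 1 < y.1 ∧ 0 ≤ y.2}, Real.exp (-x' * y.2) ∂m ≤
      ∫ y in {y : ℝ × ℝ | 1 < y.1 ∧ 0 ≤ y.2}, Real.exp (-x * y.2) ∂m := by
  have hS : MeasurableSet {y : ℝ × ℝ | 1 < y.1 ∧ 0 ≤ y.2} :=
    (measurableSet_lt measurable_const measurable_fst).inter
      (measurableSet_le measurable_const measurable_snd)
  exact setIntegral_mono_on (integrableOn_exp_neg_mul_snd hm (hx.trans hxx'))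
    (integrableOn_exp_neg_mul_snd hm hx) hS
    fun y hy => Real.exp_le_exp.2 (by nlinarith [hy.2])

theorem continuousOn_setIntegral_exp_neg_mul_snd {m : Measure (ℝ × ℝ)}
    (hm : m {y | 1 < y.1} ≠ ⊤) :
    ContinuousOn (fun x : ℝ => ∫ y in {y : ℝ × ℝ | 1 < y.1 ∧ 0 ≤ y.2}, Real.exp (-x * y.2) ∂m)
      (Set.Ici 0) := by
  have hS : MeasurableSet {y : ℝ × ℝ | 1 < y.1 ∧ 0 ≤ y.2} :=
    (measurableSet_lt measurable_const measurable_fst).inter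
      (measurableSet_le measurable_const measurable_snd)
  refine continuousOn_of_dominated (bound := fun _ => 1) (fun x _ => ?_) (fun x hx => ?_) ?_ ?_
  · exact (by fun_prop : Measurable fun y : ℝ × ℝ => Real.exp (-x * y.2)).aestronglyMeasurable
  · refine (ae_restrict_iff' hS).2 (Eventually.of_forall fun y hy => ?_)
    rw [Real.norm_of_nonneg (Real.exp_pos _).le]
    have hx : 0 ≤ x := hx
    exact Real.exp_le_one_iff.2 (by nlinarith [hy.2])
  · exact integrableOn_const (ne_top_of_le_ne_top hm (measure_mono fun y hy => hy.1))
  · exact Eventually.of_forall fun y => by fun_prop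

/-- A positive multiple of a power, minus a positive nonincreasing continuous function, has a zero. -/
theorem exists_pos_mul_rpow_eq {I : ℝ → ℝ} {K α : ℝ} (hK : 0 < K) (hα : 0 < α)
    (hI : AntitoneOn I (Set.Ici 0)) (hIc : ContinuousOn I (Set.Ici 0)) (hI1 : 0 < I 1) :
    ∃ C, 0 < C ∧ K * C ^ α - I C = 0 := by
  have h0 : Tendsto (fun x : ℝ => K * x ^ α) (𝓝[>] 0) (𝓝 0) := by
    have := ((Real.continuousAt_rpow_const 0 α (Or.inr hα.le)).tendsto).const_mul K
    rw [Real.zero_rpow hα.ne', mul_zero] at this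
    exact this.mono_left nhdsWithin_le_nhds
  -- The sign change is located by comparison with the single value `I 1`: `K * a ^ α < I 1 ≤ I a`
  -- for a small `a < 1`, and `K * b ^ α > I 1 ≥ I b` for a large `b ≥ 1`.
  obtain ⟨a, ha, ha0, ha1⟩ := ((h0.eventually_lt_const hI1).and (Ioo_mem_nhdsGT one_pos)).exists
  obtain ⟨b, hb, hb1⟩ := ((((tendsto_rpow_atTop hα).const_mul_atTop hK).eventually_gt_atTop
    (I 1)).and (eventually_ge_atTop 1)).exists
  have hIa : I 1 ≤ I a := hI (Set.mem_Ici.2 ha0.le) (Set.mem_Ici.2 zero_le_one) ha1.le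
  have hIb : I b ≤ I 1 := hI (Set.mem_Ici.2 zero_le_one) (Set.mem_Ici.2 (zero_le_one.trans hb1)) hb1
  have hcont : ContinuousOn (fun x => K * x ^ α - I x) (Set.Icc a b) := by
    refine ContinuousOn.sub (continuousOn_const.mul fun x hx => ?_)
      (hIc.mono fun x hx => ha0.le.trans hx.1)
    exact (Real.continuousAt_rpow_const x α (Or.inr hα.le)).continuousWithinAt
  obtain ⟨C, hC, hC0⟩ := intermediate_value_Icc (by linarith : a ≤ b) hcont
    (show (0 : ℝ) ∈ Set.Icc _ _ from ⟨by linarith, by linarith⟩)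
  exact ⟨C, ha0.trans_le hC.1, hC0⟩

/-! ### The main theorem. -/

theorem theorem3 {Ω Ω' : Type*} [MeasurableSpace Ω] [MeasurableSpace Ω']
    (P : Measure Ω) [IsProbabilityMeasure P] (P' : Measure Ω') [IsProbabilityMeasure P']
    (νt : Ω → ℝ≥0) (ν : Ω → ℕ) (hνt : Measurable νt) (hν : Measurable ν)
    (hmean : ∫ ω, (ν ω : ℝ) ∂P = 1)
    -- the solution of the distributional equation
    (Mk : ℕ → Ω → ℝ≥0) (M : Ω' → ℝ≥0) (hM : SolvesMaxEquation P P' νt ν Mk M)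
    -- an arbitrary norm on the plane
    (N : Seminorm ℝ (ℝ × ℝ)) (hN : ∀ y, N y = 0 → y = 0)
    -- joint regular variation, with the tail function of the norm as normalization
    (α : ℝ) (hα₁ : 1 < α) (hα₂ : α < 2) (μ : Measure (ℝ × ℝ))
    (hX : RegularlyVaryingVector P (fun ω => ((νt ω : ℝ), (ν ω : ℝ))) α
      (fun x => P.real {ω | x < N ((νt ω : ℝ), (ν ω : ℝ))}) μ)
    (hμ₁ : 0 < μ {y | 0 < y.1 ∧ 1 < y.2})
    (hμ₂ : μ {y | 0 ≤ y.1 ∧ y.2 = 1 ∧ 1 < N y} = 0)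
    (c₁ c₂ : ℝ) (hc₁ : 0 < c₁) (hc₂ : 0 < c₂)
    (hlim₁ : Tendsto (fun x : ℝ => P.real {ω | x < (ν ω : ℝ)} /
      P.real {ω | x < N ((νt ω : ℝ), (ν ω : ℝ))}) atTop (𝓝 c₁))
    (hlim₂ : Tendsto (fun x : ℝ => P.real {ω | x < (νt ω : ℝ)} /
      P.real {ω | x < N ((νt ω : ℝ), (ν ω : ℝ))}) atTop (𝓝 c₂)) :
    -- the integral in the equation for the constant converges
    (∀ x : ℝ, 0 < x → IntegrableOn (fun y : ℝ × ℝ => Real.exp (-x * y.2))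
      {y | 1 < y.1 ∧ 0 ≤ y.2} μ) ∧
    ∃ C : ℝ,
      -- `C` is a positive solution of the equation
      0 < C ∧
      c₁ * α * Real.Gamma (-α) * C ^ α -
        ∫ y in {y : ℝ × ℝ | 1 < y.1 ∧ 0 ≤ y.2}, Real.exp (-C * y.2) ∂μ = 0 ∧
      -- it is the only one
      (∀ x : ℝ, 0 < x →
        c₁ * α * Real.Gamma (-α) * x ^ α -
          ∫ y in {y : ℝ × ℝ | 1 < y.1 ∧ 0 ≤ y.2}, Real.exp (-x * y.2) ∂μ = 0 → x = C) ∧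
      -- the tail asymptotics
      (fun r : ℝ => P'.real {ω | r < (M ω : ℝ)}) ~[atTop] (fun r : ℝ => C / r) := by
  set V : ℝ → ℝ := fun x => P.real {ω | x < N ((νt ω : ℝ), (ν ω : ℝ))} with hVdef
  have hVanti : Antitone V := fun a b hab =>
    measureReal_mono fun ω (h : b < N ((νt ω : ℝ), (ν ω : ℝ))) => hab.trans_lt h
  have hVpos := hX.regularlyVarying.pos
  have hAm : Measurable fun ω => (νt ω : ℝ) := by fun_prop
  have hνm : Measurable fun ω => (ν ω : ℝ) := measurable_from_nat.comp hν
  have hμfin : μ {y | 1 < y.1} ≠ ⊤ :=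
    ne_top_of_le_ne_top ENNReal.ofReal_ne_top (hX.measure_lt_fst_le hAm hνm hlim₂ one_pos)
  set I : ℝ → ℝ := fun x => ∫ y in {y : ℝ × ℝ | 1 < y.1 ∧ 0 ≤ y.2}, Real.exp (-x * y.2) ∂μ with hI
  have hIanti : AntitoneOn I (Set.Ici 0) := fun x hx x' _ hxx' =>
    setIntegral_exp_neg_mul_snd_antitone hμfin hx hxx'
  have hK : 0 < c₁ * α * Real.Gamma (-α) := by
    rw [mul_assoc]; exact mul_pos hc₁ (mul_Gamma_neg_pos hα₁ hα₂)
  have hα0 : 0 < α := by linarith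
  -- Strict monotonicity yields both uniqueness of `C` and the signs of the limiting defect on its
  -- two sides.
  have hmono : ∀ x y, 0 < x → x < y → c₁ * α * Real.Gamma (-α) * x ^ α - I x <
      c₁ * α * Real.Gamma (-α) * y ^ α - I y := by
    intro x y hx hxy
    have h1 := mul_lt_mul_of_pos_left (Real.rpow_lt_rpow hx.le hxy hα0) hK
    have h2 : I y ≤ I x := hIanti hx.le (hx.trans hxy).le hxy.le
    linarith
  obtain ⟨C, hC0, hC⟩ := exists_pos_mul_rpow_eq hK hα0 hIanti
    (continuousOn_setIntegral_exp_neg_mul_snd hμfin)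
    (setIntegral_exp_pos hX hAm hν hα₁ hc₂ hlim₁ hlim₂)
  refine ⟨fun x hx => integrableOn_exp_neg_mul_snd hμfin hx.le, C, hC0, hC, ?_, ?_⟩
  · intro x hx hx0
    by_contra hne
    rcases lt_or_gt_of_ne hne with h | h
    · linarith [hmono x C hx h]
    · linarith [hmono C x hC0 h]
  have hdef := fun {x : ℝ} (hx : 0 < x) => tendsto_fixedPoint_defect_div hX hVanti
    (fun x => measureReal_le_one) hAm hν hmean hα₁ hα₂ hc₁ hc₂ hlim₁ hlim₂ hx
  have hfix := fun {r : ℝ} (hr : 0 ≤ r) => hM.one_sub_tail_eq hνt hν hr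
  set G : ℝ → ℝ := fun r => P'.real {ω | r < (M ω : ℝ)} with hG
  have hlim : Tendsto (fun r => r * G r) atTop (𝓝 C) := by
    refine tendsto_order.2 ⟨fun a ha => ?_, fun a ha => ?_⟩
    · obtain ⟨x, hax, hxC⟩ := exists_between (max_lt ha hC0)
      have hx : 0 < x := (le_max_right _ _).trans_lt hax
      have hneg : c₁ * α * Real.Gamma (-α) * x ^ α - I x < 0 := hC ▸ hmono x C hx hxC
      filter_upwards [(hdef hx).eventually_lt_const hneg, eventually_ge_atTop x] with r h1 hr
      have hr0 : 0 < r := hx.trans_le hr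
      refine ((le_max_left _ _).trans_lt hax).trans ?_
      rw [div_lt_iff₀ (hVpos r hr0), zero_mul] at h1
      -- If `G r ≤ x / r`, monotonicity would put the defect at `G r`, which is zero, below the
      -- negative defect at `x / r`.
      by_contra! hle
      have h2 : G r ≤ x / r := by rwa [le_div_iff₀ hr0, mul_comm]
      have h3 := setIntegral_one_sub_pow_sub_mono hν hmean {ω | (νt ω : ℝ) ≤ r}
        (measureReal_nonneg : 0 ≤ G r) h2 (by rwa [div_le_one hr0])
      linarith [hfix hr0.le]
    · obtain ⟨x, hCx, hxa⟩ := exists_between ha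
      have hx : 0 < x := hC0.trans hCx
      have hpos : 0 < c₁ * α * Real.Gamma (-α) * x ^ α - I x := hC ▸ hmono C x hC0 hCx
      filter_upwards [(hdef hx).eventually_const_lt hpos, eventually_ge_atTop x] with r h1 hr
      have hr0 : 0 < r := hx.trans_le hr
      refine lt_trans ?_ hxa
      rw [lt_div_iff₀ (hVpos r hr0), zero_mul] at h1
      by_contra! hle
      have h2 : x / r ≤ G r := by rwa [div_le_iff₀ hr0, mul_comm]
      have h3 := setIntegral_one_sub_pow_sub_mono hν hmean {ω | (νt ω : ℝ) ≤ r}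
        (by positivity : 0 ≤ x / r) h2 measureReal_le_one
      linarith [hfix hr0.le]
  refine isEquivalent_of_tendsto_one ?_
  have := hlim.div_const C
  rw [div_self hC0.ne'] at this
  refine this.congr fun r => ?_
  simp only [Pi.div_apply]
  rw [div_div_eq_mul_div, mul_comm]
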